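/- For a convex function $F:\mathbb{R}^n\to\mathbb{R}$ let $X_F$ denote the unique linear subspace $X$ of $\mathbb{R}^n$ for which there are a vector $v\in X^{\perp}$ and an essentially coercive function $c:X\to\mathbb{R}$ with $F(x)=c(P_X(x))+\langle v,x\rangle$ for all $x\in\mathbb{R}^n$. Here $P_Z$ denotes the orthogonal projection of $\mathbb{R}^n$ onto a subspace $Z$, and $c$ is called essentially coercive if there is a linear function $\ell:X\to\mathbb{R}$ with $c(x)-\ell(x)\to\infty$ as $|x|\to\infty$. **Theorem.** Let $E$ be an arbitrary subset of $\mathbb{R}^n$, $X\subseteq\mathbb{R}^n$ a linear subspace, and $f:E\to\mathbb{R}$, $G:E\to\mathbb{R}^n$ two functions. There exists a Lipschitz convex function $F:\mathbb{R}^n\to\mathbb{R}$ of class $C^1$ such that $F|_E=f$, $(\nabla F)|_E=G$ and $X_F=X$ if and only if the following conditions are satisfied. - (i) $G$ is continuous and bounded, and $f(x)\ge f(y)+\langle G(y),x-y\rangle$ for all $x,y\in E$. - (ii) $Y:=\mathrm{span}\{G(x)-G(y): x,y\in E\}\subseteq X$. - (iii) If $Y\neq X$ and $k=\dim Y$, $d=\dim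 X$, there exist points $p_1,\dots,p_{d-k}\in\mathbb{R}^n\setminus\overline{E}$, a number $\varepsilon\in(0,1)$, and linearly independent unit vectors $w_1,\dots,w_{d-k}\in X\cap Y^{\perp}$ such that, for every $j=1,\dots,d-k$, the cone $V_j:=\{x\in\mathbb{R}^n:\varepsilon\langle w_j,x-p_j\rangle\ge|P_Y(x-p_j)|\}$ does not contain any point of $\overline{E}$. - (iv) If $(x_k)_k,(z_k)_k$ are sequences in $E$ such that $(P_X(x_k))_k$ is bounded and $\lim_{k\to\infty}\bigl(f(x_k)-f(z_k)-\langle G(z_k),x_k-z_k\rangle\bigr)=0$, then $\lim_{k\to\infty}|G(x_k)-G(z_k)|=0$. Moreover, there exists a constant $C(n)>0$ depending only on $n$ such that, whenever these conditions are satisfied and either $X=\{0\}$ or $G$ is not identically zero on $E$, the extension $F$ can be taken so that $$\mathrm{Lip}(F)=\sup_{x\in\mathbb{R}^n}|\nabla F(x)|\le C(n)\,\sup_{y\in E}|G(y)|,$$ where $\mathrm{Lip}(F)$ is the least Lipschitz constant of $F$, and the last supremum is read as $0$ if $E=\emptyset$. -/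

import Mathlib

open Filter Topology
open scoped InnerProductSpace

/-- A function `c` on a normed space is essentially coercive if, after subtracting some linear
function, it tends to `+∞` as the norm of the variable tends to `+∞`. -/
def EssentiallyCoercive {Z : Type*} [NormedAddCommGroup Z] [NormedSpace ℝ Z] (c : Z → ℝ) : Prop :=
  ∃ ℓ : Z →ₗ[ℝ] ℝ, Tendsto (fun z => c z - ℓ z) (Bornology.cobounded Z) atTop

/-- `IsCoercivitySubspace F X` says that `X = X_F`: there are `v ∈ Xᗮ` and an essentially coercive
`c : X → ℝ` with `F x = c (P_X x) + ⟪v, x⟫` for all `x`. At most one subspace `X` has this property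
(`IsCoercivitySubspace.unique`), and for convex `F` it is the subspace denoted by `X_F`. -/
def IsCoercivitySubspace {n : ℕ} (F : EuclideanSpace ℝ (Fin n) → ℝ)
    (X : Submodule ℝ (EuclideanSpace ℝ (Fin n))) : Prop :=
  ∃ v ∈ Xᗮ, ∃ c : X → ℝ, EssentiallyCoercive c ∧
    ∀ x, F x = c (X.orthogonalProjectionOnto x) + ⟪v, x⟫_ℝ

/-- The orthogonal complement of `X_F` consists of the directions along which `F` is affine. -/
theorem IsCoercivitySubspace.mem_orthogonal_iff {n : ℕ} {F : EuclideanSpace ℝ (Fin n) → ℝ}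
    {X : Submodule ℝ (EuclideanSpace ℝ (Fin n))} (h : IsCoercivitySubspace F X)
    (u : EuclideanSpace ℝ (Fin n)) :
    u ∈ Xᗮ ↔ ∃ a b : ℝ, ∀ t : ℝ, F (t • u) = a + t * b := by
  obtain ⟨v, hv, c, ⟨ℓ, hℓ⟩, hF⟩ := h
  constructor
  · intro hu
    refine ⟨c 0, ⟪v, u⟫_ℝ, fun t => ?_⟩
    rw [hF, map_smul, (Submodule.orthogonalProjectionOnto_eq_zero_iff).2 hu, smul_zero,
      real_inner_smul_right]
  · rintro ⟨a, b, hab⟩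
    rw [← Submodule.orthogonalProjectionOnto_eq_zero_iff]
    by_contra hne
    set q := X.orthogonalProjectionOnto u with hq
    have hlin : ∀ t : ℝ, c (t • q) - ℓ (t • q) = a + t * (b - ⟪v, u⟫_ℝ - ℓ q) := by
      intro t
      have h1 := hab t
      rw [hF, map_smul, real_inner_smul_right, ← hq] at h1
      rw [map_smul, smul_eq_mul]
      linarith
    have hcob : Tendsto (fun t : ℝ => t • q) (Bornology.cobounded ℝ) (Bornology.cobounded X) := by
      rw [← tendsto_norm_atTop_iff_cobounded]
      simp only [norm_smul]
      exact tendsto_norm_cobounded_atTop.atTop_mul_const (norm_pos_iff.2 hne)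
    have ht := hℓ.comp hcob
    have h1 := (ht.mono_left (IsOrderBornology.atTop_le_cobounded (α := ℝ)))
    have h2 := (ht.mono_left (IsOrderBornology.atBot_le_cobounded (α := ℝ))).comp
      tendsto_neg_atTop_atBot
    have h3 := ((h1.atTop_add_atTop h2).eventually_gt_atTop (2 * a)).exists
    obtain ⟨t, ht⟩ := h3
    simp only [Function.comp_apply, hlin] at ht
    linarith

theorem IsCoercivitySubspace.unique {n : ℕ} {F : EuclideanSpace ℝ (Fin n) → ℝ}
    {X X' : Submodule ℝ (EuclideanSpace ℝ (Fin n))} (h : IsCoercivitySubspace F X)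
    (h' : IsCoercivitySubspace F X') : X = X' := by
  have : Xᗮ = X'ᗮ := by
    ext u
    rw [h.mem_orthogonal_iff, h'.mem_orthogonal_iff]
  rw [← X.orthogonal_orthogonal, this, X'.orthogonal_orthogonal]

/-- `Lip(F)`: the least Lipschitz constant of a Lipschitz function `F`. -/
noncomputable def lipConst {n : ℕ} (F : EuclideanSpace ℝ (Fin n) → ℝ) : ℝ :=
  sInf {L : ℝ | 0 ≤ L ∧ ∀ x y, |F x - F y| ≤ L * ‖x - y‖}

/-- The subspace `Y = span {G x - G y : x, y ∈ E}`. -/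
def jetSpan {n : ℕ} {E : Set (EuclideanSpace ℝ (Fin n))} (G : E → EuclideanSpace ℝ (Fin n)) :
    Submodule ℝ (EuclideanSpace ℝ (Fin n)) :=
  Submodule.span ℝ {g | ∃ x y : E, g = G x - G y}

/-- The cone `{x : ε ⟪w, x - p⟫ ≥ |P_Y (x - p)|}` with vertex `p`. -/
def jetCone {n : ℕ} (Y : Submodule ℝ (EuclideanSpace ℝ (Fin n))) (ε : ℝ)
    (w p : EuclideanSpace ℝ (Fin n)) : Set (EuclideanSpace ℝ (Fin n)) :=
  {x | ε * ⟪w, x - p⟫_ℝ ≥ ‖Y.orthogonalProjectionOnto (x - p)‖}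

/-- `F` is a Lipschitz convex function of class `C¹` on `ℝⁿ` such that `(F, ∇F)` extends the jet
`(f, G)` and `X_F = X`. -/
structure IsLipschitzConvexExtension {n : ℕ} {E : Set (EuclideanSpace ℝ (Fin n))}
    (X : Submodule ℝ (EuclideanSpace ℝ (Fin n))) (f : E → ℝ) (G : E → EuclideanSpace ℝ (Fin n))
    (F : EuclideanSpace ℝ (Fin n) → ℝ) : Prop where
  lipschitz : ∃ L, LipschitzWith L F
  convex : ConvexOn ℝ Set.univ F
  contDiff : ContDiff ℝ 1 F
  value_eq : ∀ x : E, F x = f x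
  gradient_eq : ∀ x : E, gradient F x = G x
  subspace_eq : IsCoercivitySubspace F X

/-- The four conditions on a jet `(f, G)` on `E` and a subspace `X`. -/
structure LipschitzJetConditions {n : ℕ} {E : Set (EuclideanSpace ℝ (Fin n))}
    (X : Submodule ℝ (EuclideanSpace ℝ (Fin n))) (f : E → ℝ)
    (G : E → EuclideanSpace ℝ (Fin n)) : Prop where
  /-- `G` is continuous and bounded, and the data are convex. -/
  basic : Continuous G ∧ Bornology.IsBounded (Set.range G) ∧
    ∀ x y : E, f x ≥ f y + ⟪G y, (x : EuclideanSpace ℝ (Fin n)) - y⟫_ℝ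
  /-- `Y ⊆ X`. -/
  span_le : jetSpan G ≤ X
  /-- If `Y ≠ X`, there are `dim X - dim Y` cones that miss the closure of `E`. -/
  cones : jetSpan G ≠ X →
    ∃ (p : Fin (Module.finrank ℝ X - Module.finrank ℝ (jetSpan G)) → EuclideanSpace ℝ (Fin n))
      (ε : ℝ)
      (w : Fin (Module.finrank ℝ X - Module.finrank ℝ (jetSpan G)) → EuclideanSpace ℝ (Fin n)),
      (∀ j, p j ∉ closure E) ∧ 0 < ε ∧ ε < 1 ∧ LinearIndependent ℝ w ∧ (∀ j, ‖w j‖ = 1) ∧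
      (∀ j, w j ∈ X ⊓ (jetSpan G)ᗮ) ∧
      ∀ j, ∀ x ∈ closure E, x ∉ jetCone (jetSpan G) ε (w j) (p j)
  /-- The sequential condition, for sequences with `P_X (x k)` bounded. -/
  sequences : ∀ x z : ℕ → E,
    Bornology.IsBounded
      (Set.range fun k => X.orthogonalProjectionOnto (x k : EuclideanSpace ℝ (Fin n))) →
    Tendsto (fun k => f (x k) - f (z k) -
      ⟪G (z k), (x k : EuclideanSpace ℝ (Fin n)) - z k⟫_ℝ) atTop (𝓝 0) →
    Tendsto (fun k => ‖G (x k) - G (z k)‖) atTop (𝓝 0)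

/-! Sufficiency. Suppose first that the slope differences span X. Then the supremum of the affine
functions of the jet grows linearly along X, after subtraction of a linear function, and projecting
to X leaves a coercive problem. There condition (iv) gives, for all base points of norm at most n,
one modulus Θ_n with uniformly o(|h|) second differences such that every affine function of the jet
lies below f i + ⟪g i, x - p i⟫ + Θ_n (x - p i). The extension is the convex envelope of these upper
functions with Θ doubled. The doubling makes them grow away from p i, so near-optimal convex
combinations at a given point put weight at least 1/2 on points governed by finitely many moduli.
The envelope then has o(|h|) second differences and is differentiable (`exists_modulus`,
`lowerHull_second_difference_le`, `exists_coercive_extension`).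

If the span is too small, each cone of (iii) has room for one additional jet whose slope points
along w_j. Its gaps to all other jets are at least 1, so it does not disturb (iv)
(`exists_additional_jets`).

Necessity. F is affine along Xᗮ with one common slope, so its gradient depends only on P_X and is
uniformly continuous where P_X is bounded. This gives (ii) and (iv). Points where the gradient has
independent components in Yᗮ serve as vertices of the cones, and monotonicity of the gradient keeps
E out of them (`IsCoercivitySubspace.span_gradient`, `ConvexOn.notMem_jetCone`). -/

/-! ### Subgradients and differentiability of convex functions. -/

theorem ConvexOn.exists_subgradient {V : Type*} [NormedAddCommGroup V] [InnerProductSpace ℝ V]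
    [CompleteSpace V] {F : V → ℝ} (hF : ConvexOn ℝ Set.univ F) (hc : Continuous F) (x : V) :
    ∃ ξ : V, ∀ y, F x + ⟪ξ, y - x⟫_ℝ ≤ F y := by
  have hs : Convex ℝ {p : V × ℝ | F p.1 < p.2} := by
    simpa using hF.convex_strict_epigraph
  have ho : IsOpen {p : V × ℝ | F p.1 < p.2} :=
    isOpen_lt (hc.comp continuous_fst) continuous_snd
  obtain ⟨φ, hφ⟩ := geometric_hahn_banach_open_point hs ho (x := (x, F x)) (by simp)
  have hsplit : ∀ (v : V) (t : ℝ), φ (v, t) = φ (v, 0) + t * φ (0, 1) := by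
    intro v t
    have : ((v, t) : V × ℝ) = (v, 0) + t • (0, 1) := by simp
    rw [this, map_add, map_smul, smul_eq_mul]
  -- The separating hyperplane is not vertical, because points above (x, F x) lie in the strict
  -- epigraph. Dividing by -β turns it into a subgradient.
  have hβ : φ (0, 1) < 0 := by
    have := hφ (x, F x + 1) (by simp)
    rw [hsplit x (F x + 1), hsplit x (F x)] at this
    linarith
  set β := φ (0, 1) with hβdef
  have hle : ∀ y, φ (y, 0) + F y * β ≤ φ (x, 0) + F x * β := by
    intro y
    refine le_of_forall_pos_le_add fun ε hε => ?_
    have := hφ (y, F y + ε / -β) (by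
      have : 0 < ε / -β := div_pos hε (by linarith)
      simpa using this)
    rw [hsplit y, hsplit x (F x)] at this
    have h2 : ε / -β * β = -ε := by field_simp [hβ.ne]
    nlinarith
  refine ⟨(InnerProductSpace.toDual ℝ V).symm ((-β)⁻¹ • φ.comp (ContinuousLinearMap.inl ℝ V ℝ)),
    fun y => ?_⟩
  rw [InnerProductSpace.toDual_symm_apply]
  have h1 := hle y
  have h2 : φ (y - x, 0) = φ (y, 0) - φ (x, 0) := by
    rw [← map_sub]; simp
  simp only [_root_.smul_apply, ContinuousLinearMap.comp_apply,
    ContinuousLinearMap.inl_apply, smul_eq_mul, h2]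
  have h3 : (-β)⁻¹ * (φ (y, 0) - φ (x, 0)) ≤ F y - F x := by
    rw [inv_mul_le_iff₀ (by linarith)]
    linarith
  linarith

/-- A subgradient is a gradient if the second differences at the point are `o(‖h‖)`. -/
theorem hasGradientAt_of_subgradient {V : Type*} [NormedAddCommGroup V] [InnerProductSpace ℝ V]
    [CompleteSpace V] {F : V → ℝ} {x ξ : V} (hξ : ∀ y, F x + ⟪ξ, y - x⟫_ℝ ≤ F y)
    (h2 : ∀ ε > 0, ∃ r > 0, ∀ h : V, ‖h‖ ≤ r → F (x + h) + F (x - h) - 2 * F x ≤ ε * ‖h‖) :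
    HasGradientAt F ξ x := by
  rw [hasGradientAt_iff_isLittleO_nhds_zero, Asymptotics.isLittleO_iff]
  intro ε hε
  obtain ⟨r, hr, h⟩ := h2 ε hε
  filter_upwards [Metric.closedBall_mem_nhds (0 : V) hr] with v hv
  have hv' : ‖v‖ ≤ r := by simpa using hv
  have a1 := hξ (x + v)
  have a2 := hξ (x - v)
  have a3 := h v hv'
  rw [add_sub_cancel_left] at a1
  rw [sub_sub_cancel_left, inner_neg_right] at a2
  rw [Real.norm_eq_abs, abs_le]
  constructor
  · have : 0 ≤ ε * ‖v‖ := by positivity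
    linarith
  · linarith

theorem ConvexOn.add_inner_le_of_hasGradientAt {V : Type*} [NormedAddCommGroup V]
    [InnerProductSpace ℝ V] [CompleteSpace V] {F : V → ℝ} (hF : ConvexOn ℝ Set.univ F)
    {x ξ : V} (hξ : HasGradientAt F ξ x) (y : V) : F x + ⟪ξ, y - x⟫_ℝ ≤ F y := by
  have hline : HasDerivAt (fun t : ℝ => F (x + t • (y - x))) ⟪ξ, y - x⟫_ℝ 0 := by
    have hg : HasDerivAt (fun t : ℝ => x + t • (y - x)) (y - x) 0 := by
      simpa using ((hasDerivAt_id (0 : ℝ)).smul_const (y - x)).const_add x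
    have hf : HasFDerivAt F (InnerProductSpace.toDual ℝ V ξ) (x + (0 : ℝ) • (y - x)) := by
      simpa using hξ.hasFDerivAt
    simpa [Function.comp_def] using hf.comp_hasDerivAt 0 hg
  have hconv : ConvexOn ℝ Set.univ (fun t : ℝ => F (x + t • (y - x))) := by
    have := hF.comp_affineMap (AffineMap.lineMap x y : ℝ →ᵃ[ℝ] V)
    simpa [Function.comp_def, AffineMap.lineMap_apply, add_comm] using this
  have := hconv.le_slope_of_hasDerivAt (Set.mem_univ 0) (Set.mem_univ 1) one_pos hline
  simp [slope_def_field] at this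
  linarith

/-- A subgradient at a point of differentiability is the gradient. -/
theorem HasGradientAt.eq_of_subgradient {V : Type*} [NormedAddCommGroup V]
    [InnerProductSpace ℝ V] [CompleteSpace V] {F : V → ℝ} {x ξ η : V}
    (hξ : HasGradientAt F ξ x) (hη : ∀ y, F x + ⟪η, y - x⟫_ℝ ≤ F y) : ξ = η := by
  have hmin : IsLocalMin (fun y => F y - ⟪η, y⟫_ℝ) x := by
    refine Eventually.of_forall fun y => ?_
    have := hη y
    rw [inner_sub_right] at this
    linarith
  have hd : HasFDerivAt (fun y => F y - ⟪η, y⟫_ℝ)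
      (InnerProductSpace.toDual ℝ V ξ - InnerProductSpace.toDual ℝ V η) x :=
    hξ.hasFDerivAt.sub (InnerProductSpace.toDual ℝ V η).hasFDerivAt
  have := hmin.hasFDerivAt_eq_zero hd
  exact (InnerProductSpace.toDual ℝ V).injective (sub_eq_zero.1 this)

theorem exists_norm_eq_inner_eq {V : Type*} [NormedAddCommGroup V] [InnerProductSpace ℝ V]
    (u : V) {r : ℝ} (hr : 0 ≤ r) : ∃ h : V, ‖h‖ ≤ r ∧ ⟪u, h⟫_ℝ = r * ‖u‖ := by
  by_cases hu : u = 0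
  · exact ⟨0, by simpa using hr, by simp [hu]⟩
  · have hu' : ‖u‖ ≠ 0 := norm_ne_zero_iff.2 hu
    refine ⟨(r / ‖u‖) • u, ?_, ?_⟩
    · rw [norm_smul, norm_div, norm_norm, div_mul_cancel₀ _ hu', Real.norm_of_nonneg hr]
    · rw [real_inner_smul_right, real_inner_self_eq_norm_sq]
      field_simp

/-- A Lipschitz convex function which is differentiable everywhere is of class `C¹`. -/
theorem ConvexOn.contDiff_one_of_hasGradientAt {V : Type*} [NormedAddCommGroup V]
    [InnerProductSpace ℝ V] [CompleteSpace V] {F : V → ℝ} {g : V → V}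
    (hF : ConvexOn ℝ Set.univ F) {K : ℝ} (hL : ∀ x y, |F x - F y| ≤ K * ‖x - y‖)
    (hg : ∀ x, HasGradientAt F (g x) x) : ContDiff ℝ 1 F := by
  have hcont : Continuous g := by
    rw [Metric.continuous_iff]
    intro x ε hε
    have h0 := hg x
    rw [hasGradientAt_iff_isLittleO_nhds_zero, Asymptotics.isLittleO_iff] at h0
    have h1 := h0 (show 0 < ε / 2 by linarith)
    obtain ⟨r, hr, h2⟩ := Metric.eventually_nhds_iff_ball.1 h1
    set ρ := r / 2 with hρ
    have hρ0 : 0 < ρ := by positivity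
    have hK : 0 ≤ |K| := abs_nonneg K
    refine ⟨ε * ρ / (4 * (|K| + 1)), by positivity, fun y hy => ?_⟩
    rw [dist_eq_norm] at hy ⊢
    -- Testing g y - g x in its own direction at scale ρ: convexity at y and differentiability at x
    -- give ρ‖g y - g x‖ ≤ 2K‖y - x‖ + ρε/2, which dictates the radius chosen for y.
    obtain ⟨h, hh, hin⟩ := exists_norm_eq_inner_eq (g y - g x) hρ0.le
    have b1 := hF.add_inner_le_of_hasGradientAt (hg y) (y + h)
    rw [add_sub_cancel_left] at b1
    have b2 := h2 h (by simpa using lt_of_le_of_lt hh (by linarith))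
    rw [Real.norm_eq_abs] at b2
    have b3 := (abs_le.1 b2).2
    have b4 := (abs_le.1 (hL (y + h) (x + h))).2
    have b5 := (abs_le.1 (hL y x)).1
    rw [add_sub_add_right_eq_sub] at b4
    rw [inner_sub_left] at hin
    have b6 : ε / 2 * ‖h‖ ≤ ε / 2 * ρ := by gcongr
    have b7 : K * ‖y - x‖ ≤ (|K| + 1) * ‖y - x‖ := by
      gcongr
      linarith [le_abs_self K]
    have b8 : (|K| + 1) * ‖y - x‖ < ε * ρ / 4 := by
      rw [lt_div_iff₀ (by positivity)] at hy
      linarith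
    have : ρ * ‖g y - g x‖ < ρ * ε := by linarith
    exact lt_of_mul_lt_mul_left this hρ0.le
  rw [contDiff_one_iff_fderiv]
  refine ⟨fun x => (hg x).differentiableAt, ?_⟩
  have : fderiv ℝ F = fun x => InnerProductSpace.toDual ℝ V (g x) := by
    funext x
    exact (hg x).hasFDerivAt.fderiv
  rw [this]
  exact (InnerProductSpace.toDual ℝ V).continuous.comp hcont

/-! ### A Whitney modulus built from smoothed norms. -/

/-- The smooth approximation `√(δ² + ‖v‖²) - δ` of the norm. -/
noncomputable def smoothNorm {V : Type*} [Norm V] (δ : ℝ) (v : V) : ℝ :=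
  √(δ ^ 2 + ‖v‖ ^ 2) - δ

section smoothNorm

variable {V : Type*} [NormedAddCommGroup V] {δ : ℝ}

theorem smoothNorm_zero (hδ : 0 ≤ δ) : smoothNorm δ (0 : V) = 0 := by
  simp [smoothNorm, Real.sqrt_sq hδ]

theorem smoothNorm_nonneg (v : V) : 0 ≤ smoothNorm δ v := by
  have : δ ≤ √(δ ^ 2 + ‖v‖ ^ 2) := Real.le_sqrt_of_sq_le (by nlinarith [norm_nonneg v])
  simpa [smoothNorm] using this

theorem norm_sub_le_smoothNorm (v : V) : ‖v‖ - δ ≤ smoothNorm δ v := by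
  have : ‖v‖ ≤ √(δ ^ 2 + ‖v‖ ^ 2) := Real.le_sqrt_of_sq_le (by nlinarith [sq_nonneg δ])
  simpa [smoothNorm] using this

theorem smoothNorm_sub_le (x y : V) : smoothNorm δ x - smoothNorm δ y ≤ ‖x - y‖ := by
  have h1 : ‖y‖ ≤ √(δ ^ 2 + ‖y‖ ^ 2) := Real.le_sqrt_of_sq_le (by nlinarith [sq_nonneg δ])
  have h2 : ‖x‖ ≤ ‖y‖ + ‖x - y‖ := norm_le_norm_add_norm_sub' x y
  have h3 : √(δ ^ 2 + ‖x‖ ^ 2) ≤ √(δ ^ 2 + ‖y‖ ^ 2) + ‖x - y‖ := by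
    rw [Real.sqrt_le_left (by positivity)]
    have h4 : √(δ ^ 2 + ‖y‖ ^ 2) ^ 2 = δ ^ 2 + ‖y‖ ^ 2 := Real.sq_sqrt (by positivity)
    have h5 : ‖x‖ ^ 2 ≤ (‖y‖ + ‖x - y‖) ^ 2 := by gcongr
    nlinarith [norm_nonneg (x - y)]
  simp only [smoothNorm]
  linarith

theorem abs_smoothNorm_sub_le (x y : V) : |smoothNorm δ x - smoothNorm δ y| ≤ ‖x - y‖ := by
  rw [abs_le]
  have h1 := smoothNorm_sub_le (δ := δ) x y
  have h2 := smoothNorm_sub_le (δ := δ) y x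
  rw [norm_sub_rev] at h2
  constructor <;> linarith

/-- The factor 2 is the Lipschitz estimate. The factor ‖h‖/δ comes from the parallelogram law: (a +
b)² ≤ 2(a² + b²) = 4s² + 4‖h‖² for the three square roots, with s ≥ δ. -/
theorem smoothNorm_second_difference_le [InnerProductSpace ℝ V] (hδ : 0 < δ) (v h : V) :
    smoothNorm δ (v + h) + smoothNorm δ (v - h) - 2 * smoothNorm δ v ≤
      min 2 (‖h‖ / δ) * ‖h‖ := by
  rw [min_mul_of_nonneg _ _ (norm_nonneg h)]
  refine le_min ?_ ?_
  · have h1 := smoothNorm_sub_le (δ := δ) (v + h) v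
    have h2 := smoothNorm_sub_le (δ := δ) (v - h) v
    rw [add_sub_cancel_left] at h1
    rw [sub_sub_cancel_left, norm_neg] at h2
    linarith
  · have hp := parallelogram_law_with_norm ℝ v h
    set a := √(δ ^ 2 + ‖v + h‖ ^ 2) with ha
    set b := √(δ ^ 2 + ‖v - h‖ ^ 2) with hb
    set s := √(δ ^ 2 + ‖v‖ ^ 2) with hs
    have ha2 : a ^ 2 = δ ^ 2 + ‖v + h‖ ^ 2 := Real.sq_sqrt (by positivity)
    have hb2 : b ^ 2 = δ ^ 2 + ‖v - h‖ ^ 2 := Real.sq_sqrt (by positivity)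
    have hs2 : s ^ 2 = δ ^ 2 + ‖v‖ ^ 2 := Real.sq_sqrt (by positivity)
    have hsδ : δ ≤ s := Real.le_sqrt_of_sq_le (by nlinarith [norm_nonneg v])
    have key : a + b ≤ 2 * s + ‖h‖ / δ * ‖h‖ := by
      have hq : 0 ≤ ‖h‖ / δ * ‖h‖ := by positivity
      have h1 : (a + b) ^ 2 ≤ (2 * s + ‖h‖ / δ * ‖h‖) ^ 2 := by
        have h2 : (a + b) ^ 2 ≤ 4 * s ^ 2 + 4 * ‖h‖ ^ 2 := by
          nlinarith [sq_nonneg (a - b)]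
        have h3 : ‖h‖ ^ 2 ≤ s * (‖h‖ / δ * ‖h‖) := by
          have : ‖h‖ ^ 2 = δ * (‖h‖ / δ * ‖h‖) := by field_simp
          rw [this]
          gcongr
        nlinarith
      exact (le_abs_self _).trans (abs_le_of_sq_le_sq h1 (by linarith))
    simp only [smoothNorm]
    linarith

end smoothNorm

/-- A modulus of the type needed in Whitney's theorem: given a bounded set of pairs `(s, γ)` such
that `s` is small whenever `γ` is small, all the functions `s * ‖v‖ - γ` lie below a Lipschitz
function vanishing at `0` whose second differences are uniformly `o(‖h‖)`. -/
theorem exists_modulus (V : Type*) [NormedAddCommGroup V] [InnerProductSpace ℝ V] {L : ℝ}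
    (hL : 0 < L) {S : Set (ℝ × ℝ)} (hS : ∀ z ∈ S, z.1 ≤ 2 * L ∧ 0 ≤ z.2)
    (hη : ∀ η > 0, ∃ δ > 0, ∀ z ∈ S, z.2 < δ → z.1 < η) :
    ∃ Θ : V → ℝ, Θ 0 = 0 ∧ (∀ x y, |Θ x - Θ y| ≤ 4 * L * ‖x - y‖) ∧
      (∀ v, 2 * L * (‖v‖ - 1) ≤ Θ v) ∧
      (∀ ε > 0, ∃ r > 0, ∀ v h, ‖h‖ ≤ r → Θ (v + h) + Θ (v - h) - 2 * Θ v ≤ ε * ‖h‖) ∧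
      ∀ z ∈ S, ∀ v, z.1 * ‖v‖ - z.2 ≤ Θ v := by
  -- Θ is a dyadic sum of smoothed norms with weights of total 4L. A pair with c (k + 1) < s ≤ c k
  -- is handled by the k-th term alone: then γ ≥ d k ≥ s * δ k, so s‖v‖ - γ ≤ s(‖v‖ - δ k). The
  -- bound δ 0 ≤ 1 gives the growth 2L(‖v‖ - 1).
  set c : ℕ → ℝ := fun k => 2 * L * (1 / 2) ^ k with hc
  have hc0 : ∀ k, 0 < c k := fun k => by positivity
  have hcs : HasSum c (4 * L) := by
    have := hasSum_geometric_two.mul_left (2 * L)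
    rwa [show 2 * L * 2 = 4 * L by ring] at this
  choose d hd0 hd using fun k => hη (c (k + 1)) (hc0 _)
  set δ : ℕ → ℝ := fun k => min 1 (d k / (2 * L)) with hδdef
  have hδ0 : ∀ k, 0 < δ k := fun k => lt_min one_pos (div_pos (hd0 k) (by positivity))
  have hsum : ∀ v : V, Summable fun k => c k * smoothNorm (δ k) v := by
    intro v
    refine Summable.of_nonneg_of_le (fun k => mul_nonneg (hc0 k).le (smoothNorm_nonneg v))
      (fun k => ?_) (hcs.summable.mul_right ‖v‖)
    have := smoothNorm_sub_le (δ := δ k) v 0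
    rw [smoothNorm_zero (hδ0 k).le, sub_zero, sub_zero] at this
    exact mul_le_mul_of_nonneg_left this (hc0 k).le
  have hle : ∀ (v : V) k, c k * smoothNorm (δ k) v ≤ ∑' k, c k * smoothNorm (δ k) v :=
    fun v k => (hsum v).le_tsum k fun j _ => mul_nonneg (hc0 j).le (smoothNorm_nonneg v)
  have hlip : ∀ x y : V, (∑' k, c k * smoothNorm (δ k) x) - ∑' k, c k * smoothNorm (δ k) y ≤
      4 * L * ‖x - y‖ := by
    intro x y
    rw [← (hsum x).tsum_sub (hsum y), ← hcs.tsum_eq, ← tsum_mul_right]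
    refine Summable.tsum_le_tsum (fun k => ?_) ((hsum x).sub (hsum y))
      (hcs.summable.mul_right _)
    rw [← mul_sub]
    exact mul_le_mul_of_nonneg_left (smoothNorm_sub_le x y) (hc0 k).le
  refine ⟨fun v => ∑' k, c k * smoothNorm (δ k) v, ?_, ?_, ?_, ?_, ?_⟩
  · simp [smoothNorm_zero (hδ0 _).le]
  · intro x y
    rw [abs_le]
    have h1 := hlip x y
    have h2 := hlip y x
    rw [norm_sub_rev] at h2
    constructor <;> linarith
  · intro v
    refine le_trans ?_ (hle v 0)
    have : c 0 = 2 * L := by simp [hc]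
    rw [this]
    refine mul_le_mul_of_nonneg_left ?_ (by positivity)
    have h1 := norm_sub_le_smoothNorm (δ := δ 0) v
    have h2 : δ 0 ≤ 1 := min_le_left _ _
    linarith
  · intro ε hε
    have hmin0 : ∀ (r : ℝ) k, 0 ≤ r → 0 ≤ min 2 (r / δ k) := fun r k hr =>
      le_min zero_le_two (div_nonneg hr (hδ0 k).le)
    have hmaj : ∀ r : ℝ, 0 ≤ r → Summable fun k => c k * min 2 (r / δ k) := fun r hr =>
      Summable.of_nonneg_of_le (fun k => mul_nonneg (hc0 k).le (hmin0 r k hr))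
        (fun k => mul_le_mul_of_nonneg_left (min_le_left _ _) (hc0 k).le)
        (hcs.summable.mul_right 2)
    -- The δ k may have no positive lower bound, so the uniform o(‖h‖) comes from dominated
    -- convergence.
    have hlim : Tendsto (fun r : ℝ => ∑' k, c k * min 2 (r / δ k)) (𝓝[>] 0) (𝓝 0) := by
      have : Tendsto (fun r : ℝ => ∑' k, c k * min 2 (r / δ k)) (𝓝[>] 0)
          (𝓝 (∑' k, c k * min 2 (0 / δ k))) := by
        refine tendsto_tsum_of_dominated_convergence (hcs.summable.mul_right 2) (fun k => ?_) ?_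
        · refine Tendsto.mono_left ?_ nhdsWithin_le_nhds
          have : Continuous fun r : ℝ => c k * min 2 (r / δ k) := by fun_prop
          exact this.tendsto 0
        · filter_upwards [self_mem_nhdsWithin] with r hr k
          rw [Real.norm_of_nonneg (mul_nonneg (hc0 k).le (hmin0 r k (le_of_lt hr)))]
          exact mul_le_mul_of_nonneg_left (min_le_left _ _) (hc0 k).le
      simpa using this
    obtain ⟨r, hr1, hr0⟩ :=
      ((hlim.eventually (gt_mem_nhds hε)).and self_mem_nhdsWithin).exists
    have hr0 : 0 < r := hr0
    refine ⟨r, hr0, fun v h hh => ?_⟩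
    have h1 : (∑' k, c k * smoothNorm (δ k) (v + h)) + (∑' k, c k * smoothNorm (δ k) (v - h)) -
        2 * ∑' k, c k * smoothNorm (δ k) v ≤ ∑' k, c k * min 2 (r / δ k) * ‖h‖ := by
      rw [← (hsum _).tsum_add (hsum _), ← tsum_mul_left,
        ← ((hsum _).add (hsum _)).tsum_sub ((hsum v).mul_left 2)]
      refine Summable.tsum_le_tsum (fun k => ?_) (((hsum _).add (hsum _)).sub
        ((hsum v).mul_left 2)) ((hmaj r hr0.le).mul_right _)
      have h2 := smoothNorm_second_difference_le (hδ0 k) v h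
      have h3 : min 2 (‖h‖ / δ k) * ‖h‖ ≤ min 2 (r / δ k) * ‖h‖ := by
        have := (hδ0 k).le
        gcongr
      have h4 := mul_le_mul_of_nonneg_left (h2.trans h3) (hc0 k).le
      linarith
    rw [tsum_mul_right] at h1
    exact h1.trans (mul_le_mul_of_nonneg_right (le_of_lt hr1) (norm_nonneg h))
  · rintro ⟨s, γ⟩ hz v
    obtain ⟨hs, hγ⟩ := hS _ hz
    simp only at hs hγ ⊢
    by_cases hs0 : s ≤ 0
    · refine le_trans ?_ ((mul_nonneg (hc0 0).le (smoothNorm_nonneg v)).trans (hle v 0))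
      nlinarith [norm_nonneg v]
    push Not at hs0
    obtain ⟨k, hk1, hk2⟩ := exists_nat_pow_near_of_lt_one (x := s / (2 * L)) (y := 1 / 2)
      (by positivity) (by rw [div_le_one (by positivity)]; exact hs) (by norm_num) (by norm_num)
    have hk1' : c (k + 1) < s := by
      rw [lt_div_iff₀ (by positivity)] at hk1
      simp only [hc]; linarith
    have hk2' : s ≤ c k := by
      rw [div_le_iff₀ (by positivity)] at hk2
      simp only [hc]; linarith
    have hγd : d k ≤ γ := by
      by_contra! hcon
      exact absurd (hd k _ hz hcon) (not_lt.2 hk1'.le)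
    have hsδ : s * δ k ≤ γ := by
      calc s * δ k ≤ 2 * L * (d k / (2 * L)) := by
            have := (hδ0 k).le
            gcongr
            exact min_le_right _ _
        _ = d k := by field_simp
        _ ≤ γ := hγd
    refine le_trans ?_ (hle v k)
    calc s * ‖v‖ - γ ≤ s * (‖v‖ - δ k) := by linarith
      _ ≤ s * smoothNorm (δ k) v :=
        mul_le_mul_of_nonneg_left (norm_sub_le_smoothNorm v) hs0.le
      _ ≤ _ := mul_le_mul_of_nonneg_right hk2' (smoothNorm_nonneg v)

/-! ### Convex envelopes and their second differences. -/

/-- A point of a convex hull at which a linear form, bounded below on the generating set, is not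
too large is a convex combination giving weight at least `1 / 2` to points at which the form is not
too large either. -/
theorem exists_convex_combination_of_mem_convexHull {W : Type*} [AddCommGroup W] [Module ℝ W]
    {S : Set W} {ψ : W →ₗ[ℝ] ℝ} {B T : ℝ} (hB : ∀ z ∈ S, -B ≤ ψ z) {z : W}
    (hz : z ∈ convexHull ℝ S) (hT : ψ z ≤ T) :
    ∃ α : ℝ, 1 / 2 ≤ α ∧ α ≤ 1 ∧ ∃ z₁ ∈ convexHull ℝ {w ∈ S | ψ w < 2 * T + B + 1},
      ∃ z₂ ∈ convexHull ℝ S, α • z₁ + (1 - α) • z₂ = z := by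
  set M := 2 * T + B + 1 with hM
  have hge : ∀ (m : ℝ) (A : Set W), (∀ w ∈ A, m ≤ ψ w) → ∀ w ∈ convexHull ℝ A, m ≤ ψ w :=
    fun m A hA => convexHull_min hA (convex_halfSpace_ge ψ.isLinear m)
  have hzB := hge _ _ hB z hz
  have hunion : {w ∈ S | ψ w < M} ∪ {w ∈ S | M ≤ ψ w} = S := by
    ext w
    by_cases hw : ψ w < M
    · simp [hw]
    · simp [not_lt.1 hw]
  rcases Set.eq_empty_or_nonempty {w ∈ S | ψ w < M} with hgood | hgood
  · rw [hgood, Set.empty_union] at hunion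
    rw [← hunion] at hz
    have := hge M _ (fun w hw => hw.2) z hz
    linarith
  rcases Set.eq_empty_or_nonempty {w ∈ S | M ≤ ψ w} with hbad | hbad
  · rw [hbad, Set.union_empty] at hunion
    exact ⟨1, by norm_num, le_rfl, z, by rwa [hunion], z, hz, by simp⟩
  rw [← hunion, convexHull_union hgood hbad, mem_convexJoin] at hz
  obtain ⟨z₁, h₁, z₂, h₂, α, β, hα, hβ, hαβ, rfl⟩ := hz
  obtain rfl : β = 1 - α := by linarith
  refine ⟨α, ?_, by linarith, z₁, h₁, z₂, convexHull_mono (fun w hw => hw.1) h₂, rfl⟩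
  have e₁ := hge (-B) _ (fun w hw => hB w hw.1) z₁ h₁
  have e₂ := hge M _ (fun w hw => hw.2) z₂ h₂
  simp only [map_add, map_smul, smul_eq_mul] at hT hzB
  -- Markov's inequality: weight above 1/2 on points with ψ ≥ M would force ψ z > (M - B)/2 = T +
  -- 1/2.
  by_contra! hlt
  nlinarith [mul_le_mul_of_nonneg_left e₁ hα, mul_le_mul_of_nonneg_left e₂ hβ]

/-- The lower boundary of the convex hull of a set of points `(x, t)`. -/
noncomputable def lowerHull {V : Type*} [AddCommGroup V] [Module ℝ V] (S : Set (V × ℝ)) (x : V) :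
    ℝ :=
  sInf {t | (x, t) ∈ convexHull ℝ S}

section lowerHull

variable {V : Type*} [NormedAddCommGroup V] [InnerProductSpace ℝ V] {S : Set (V × ℝ)}

theorem le_of_mem_convexHull {φ : V → ℝ} (hφ : ConvexOn ℝ Set.univ φ)
    (h : ∀ z ∈ S, φ z.1 ≤ z.2) {z : V × ℝ} (hz : z ∈ convexHull ℝ S) : φ z.1 ≤ z.2 := by
  have hc : Convex ℝ {p : V × ℝ | φ p.1 ≤ p.2} := by simpa using hφ.convex_epigraph
  exact convexHull_min h hc hz

theorem lowerHull_le {φ : V → ℝ} (hφ : ConvexOn ℝ Set.univ φ) (h : ∀ z ∈ S, φ z.1 ≤ z.2)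
    {x : V} {t : ℝ} (hz : (x, t) ∈ convexHull ℝ S) : lowerHull S x ≤ t :=
  csInf_le ⟨φ x, fun _ ht => le_of_mem_convexHull hφ h ht⟩ hz

theorem le_lowerHull {φ : V → ℝ} (hφ : ConvexOn ℝ Set.univ φ) (h : ∀ z ∈ S, φ z.1 ≤ z.2)
    (hne : ∀ x, ∃ t, (x, t) ∈ S) (x : V) : φ x ≤ lowerHull S x := by
  obtain ⟨t, ht⟩ := hne x
  exact le_csInf ⟨t, subset_convexHull ℝ S ht⟩ fun _ ht => le_of_mem_convexHull hφ h ht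

theorem exists_mem_convexHull_lt (hne : ∀ x, ∃ t, (x, t) ∈ S) (x : V) {e : ℝ} (he : 0 < e) :
    ∃ t, (x, t) ∈ convexHull ℝ S ∧ t < lowerHull S x + e := by
  obtain ⟨t, ht⟩ := hne x
  exact exists_lt_of_csInf_lt ⟨t, subset_convexHull ℝ S ht⟩ (lt_add_of_pos_right _ he)

theorem convexOn_lowerHull {φ : V → ℝ} (hφ : ConvexOn ℝ Set.univ φ) (h : ∀ z ∈ S, φ z.1 ≤ z.2)
    (hne : ∀ x, ∃ t, (x, t) ∈ S) : ConvexOn ℝ Set.univ (lowerHull S) := by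
  refine ⟨convex_univ, fun x _ y _ a b ha hb hab => le_of_forall_pos_le_add fun e he => ?_⟩
  obtain ⟨t, ht, ht'⟩ := exists_mem_convexHull_lt hne x he
  obtain ⟨s, hs, hs'⟩ := exists_mem_convexHull_lt hne y he
  have := lowerHull_le hφ h (convex_convexHull ℝ S ht hs ha hb hab)
  refine this.trans ?_
  simp only [smul_eq_mul]
  have h1 := mul_le_mul_of_nonneg_left ht'.le ha
  have h2 := mul_le_mul_of_nonneg_left hs'.le hb
  calc a * t + b * s ≤ a * (lowerHull S x + e) + b * (lowerHull S y + e) := by linarith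
    _ = a * lowerHull S x + b * lowerHull S y + (a + b) * e := by ring
    _ = _ := by rw [hab, one_mul]

/-- Stability of S under translation by (v, K‖v‖) passes to its convex hull. -/
theorem abs_lowerHull_sub_le {φ : V → ℝ} (hφ : ConvexOn ℝ Set.univ φ)
    (h : ∀ z ∈ S, φ z.1 ≤ z.2) (hne : ∀ x, ∃ t, (x, t) ∈ S) {K : ℝ}
    (hK : ∀ z ∈ S, ∀ v : V, (z.1 + v, z.2 + K * ‖v‖) ∈ S) (x y : V) :
    |lowerHull S x - lowerHull S y| ≤ K * ‖x - y‖ := by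
  have key : ∀ x y, lowerHull S x ≤ lowerHull S y + K * ‖x - y‖ := by
    intro x y
    refine le_of_forall_pos_le_add fun e he => ?_
    obtain ⟨s, hs, hs'⟩ := exists_mem_convexHull_lt hne y he
    have hsub : convexHull ℝ S ⊆
        (fun z : V × ℝ => z + (x - y, K * ‖x - y‖)) ⁻¹' convexHull ℝ S :=
      convexHull_min (fun z hz => subset_convexHull ℝ S (hK z hz (x - y)))
        ((convex_convexHull ℝ S).translate_preimage_right _ |> fun hc => by
          simpa [add_comm] using hc)
    have := hsub hs
    simp only [Set.mem_preimage, Prod.mk_add_mk, add_sub_cancel] at this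
    have := lowerHull_le hφ h this
    linarith
  rw [abs_le]
  have h1 := key x y
  have h2 := key y x
  rw [norm_sub_rev] at h2
  constructor <;> linarith

/-- This lets a second-difference bound pass from generators to their hull. The tilt τ plays the
role of a slope increment; it varies with the point and is averaged along with it. -/
theorem convex_secondDifference {C : Set (V × ℝ)} (hC : Convex ℝ C) (h : V) (e : ℝ) :
    Convex ℝ {z : V × ℝ | ∃ τ : ℝ, (z.1 + h, z.2 + τ) ∈ C ∧ (z.1 - h, z.2 - τ + e) ∈ C} := by
  rintro z ⟨τ, h1, h2⟩ w ⟨σ, h3, h4⟩ a b ha hb hab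
  refine ⟨a * τ + b * σ, ?_, ?_⟩
  · convert hC h1 h3 ha hb hab using 1
    ext
    · simp only [Prod.fst_add, Prod.smul_fst, Prod.smul_mk, Prod.mk_add_mk]
      have : h = a • h + b • h := by rw [← add_smul, hab, one_smul]
      nth_rewrite 1 [this]
      module
    · simp
      ring
  · convert hC h2 h4 ha hb hab using 1
    ext
    · simp only [Prod.fst_add, Prod.smul_fst, Prod.smul_mk, Prod.mk_add_mk]
      have : h = a • h + b • h := by rw [← add_smul, hab, one_smul]
      nth_rewrite 1 [this]
      module
    · simp
      have : e = a * e + b * e := by rw [← add_mul, hab, one_mul]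
      nth_rewrite 1 [this]
      ring

/-- Second differences of the lower hull are controlled by those of the generating set at points
where a linear form is not too large. -/
theorem lowerHull_second_difference_le {φ : V → ℝ} (hφ : ConvexOn ℝ Set.univ φ)
    (h : ∀ z ∈ S, φ z.1 ≤ z.2) (hne : ∀ x, ∃ t, (x, t) ∈ S) {ψ : V × ℝ →ₗ[ℝ] ℝ} {B : ℝ}
    (hB : ∀ z ∈ S, -B ≤ ψ z)
    (h2 : ∀ M, ∀ ε > 0, ∃ r > 0, ∀ z ∈ S, ψ z < M → ∀ v : V, ‖v‖ ≤ r →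
      ∃ τ : ℝ, (z.1 + v, z.2 + τ) ∈ S ∧ (z.1 - v, z.2 - τ + ε * ‖v‖) ∈ S)
    (x : V) (ε : ℝ) (hε : 0 < ε) :
    ∃ r > 0, ∀ v : V, ‖v‖ ≤ r →
      lowerHull S (x + v) + lowerHull S (x - v) - 2 * lowerHull S x ≤ ε * ‖v‖ := by
  set T := ψ (x, lowerHull S x) + |ψ (0, 1)| with hT
  obtain ⟨r, hr, hgood⟩ := h2 (2 * T + B + 1) ε hε
  refine ⟨r / 2, by positivity, fun v hv => le_of_forall_pos_le_add fun e he => ?_⟩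
  obtain ⟨t, ht, ht'⟩ := exists_mem_convexHull_lt hne x (show 0 < min 1 (e / 2) by positivity)
  have hge := lowerHull_le hφ h ht
  have hψ : ψ (x, t) ≤ T := by
    have : ((x, t) : V × ℝ) = (x, lowerHull S x) + (t - lowerHull S x) • (0, 1) := by simp
    rw [this, map_add, map_smul, smul_eq_mul, hT]
    have h1 : t - lowerHull S x ≤ 1 := by linarith [min_le_left 1 (e / 2)]
    have h3 : (t - lowerHull S x) * ψ (0, 1) ≤ (t - lowerHull S x) * |ψ (0, 1)| :=
      mul_le_mul_of_nonneg_left (le_abs_self _) (by linarith)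
    have h4 : (t - lowerHull S x) * |ψ (0, 1)| ≤ 1 * |ψ (0, 1)| := by gcongr
    linarith
  obtain ⟨α, hα, hα1, z₁, hz₁, z₂, hz₂, hz⟩ :=
    exists_convex_combination_of_mem_convexHull hB ht hψ
  have hα0 : 0 < α := by linarith
  -- Only the part z₁ of weight α is moved, by u = α⁻¹ • v, so that the whole combination moves by
  -- v. Since α ≥ 1/2, ‖u‖ ≤ 2‖v‖ ≤ r, and the error α ε‖u‖ is exactly ε‖v‖.
  set u := α⁻¹ • v with hu
  have hun : α * ‖u‖ = ‖v‖ := by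
    rw [hu, norm_smul, norm_inv, Real.norm_of_nonneg hα0.le, mul_inv_cancel_left₀ hα0.ne']
  have hur : ‖u‖ ≤ r := by nlinarith [norm_nonneg u]
  have huv : α • u = v := by rw [hu, smul_inv_smul₀ hα0.ne']
  obtain ⟨τ, h3, h4⟩ := convexHull_min (fun w hw => by
    obtain ⟨τ, h5, h6⟩ := hgood w hw.1 hw.2 u hur
    exact ⟨τ, subset_convexHull ℝ S h5, subset_convexHull ℝ S h6⟩)
    (convex_secondDifference (convex_convexHull ℝ S) u (ε * ‖u‖)) hz₁
  have h5 := convex_convexHull ℝ S h3 hz₂ hα0.le (sub_nonneg.2 hα1) (by ring)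
  have h6 := convex_convexHull ℝ S h4 hz₂ hα0.le (sub_nonneg.2 hα1) (by ring)
  have hx : α • z₁.1 + (1 - α) • z₂.1 = x := congrArg Prod.fst hz
  have ht2 : α * z₁.2 + (1 - α) * z₂.2 = t := congrArg Prod.snd hz
  have e5 : α • (z₁.1 + u, z₁.2 + τ) + (1 - α) • z₂ = (x + v, t + α * τ) := by
    ext
    · simp only [Prod.fst_add, Prod.smul_fst, ← hx, ← huv]
      module
    · simp only [Prod.snd_add, Prod.smul_snd, ← ht2, smul_eq_mul]
      ring
  have e6 : α • (z₁.1 - u, z₁.2 - τ + ε * ‖u‖) + (1 - α) • z₂ =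
      (x - v, t - α * τ + ε * ‖v‖) := by
    ext
    · simp only [Prod.fst_add, Prod.smul_fst, ← hx, ← huv]
      module
    · simp only [Prod.snd_add, Prod.smul_snd, ← ht2, smul_eq_mul, ← hun]
      ring
  rw [e5] at h5
  rw [e6] at h6
  have h7 := lowerHull_le hφ h h5
  have h8 := lowerHull_le hφ h h6
  linarith [min_le_right 1 (e / 2)]

end lowerHull

/-! ### The extension theorem for coercive jets. -/

/-- Extension of a coercive family of convex 1-jets to a Lipschitz convex function of class
`C¹`. -/
theorem exists_coercive_extension {V : Type*} [NormedAddCommGroup V] [InnerProductSpace ℝ V]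
    [CompleteSpace V] {ι : Type*} [Nonempty ι] {p : ι → V} {f : ι → ℝ} {g : ι → V} {L : ℝ}
    (hL : 0 < L) (hg : ∀ i, ‖g i‖ ≤ L) (hgap : ∀ i j, f j + ⟪g j, p i - p j⟫_ℝ ≤ f i)
    (hmod : ∀ R, ∀ η > 0, ∃ δ > 0, ∀ i j, ‖p i‖ ≤ R →
      f i - (f j + ⟪g j, p i - p j⟫_ℝ) < δ → ‖g i - g j‖ < η)
    {l : V} {a b : ℝ} (ha : 0 < a)
    (hco : ∀ x, ∃ i, ⟪l, x⟫_ℝ + a * ‖x‖ - b ≤ f i + ⟪g i, x - p i⟫_ℝ) :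
    ∃ F : V → ℝ, ConvexOn ℝ Set.univ F ∧ (∀ x y, |F x - F y| ≤ 9 * L * ‖x - y‖) ∧
      ContDiff ℝ 1 F ∧ (∀ i, F (p i) = f i) ∧ (∀ i, HasGradientAt F (g i) (p i)) ∧
      ∀ x, ⟪l, x⟫_ℝ + a * ‖x‖ - b ≤ F x := by
  have hΘ : ∀ n : ℕ, ∃ Θ : V → ℝ, Θ 0 = 0 ∧ (∀ x y, |Θ x - Θ y| ≤ 4 * L * ‖x - y‖) ∧
      (∀ v, 2 * L * (‖v‖ - 1) ≤ Θ v) ∧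
      (∀ ε > 0, ∃ r > 0, ∀ v h, ‖h‖ ≤ r → Θ (v + h) + Θ (v - h) - 2 * Θ v ≤ ε * ‖h‖) ∧
      ∀ i j, ‖p i‖ ≤ n → ∀ v,
        f j + ⟪g j, p i + v - p j⟫_ℝ ≤ f i + ⟪g i, v⟫_ℝ + Θ v := by
    intro n
    -- At p i + v the affine function of j exceeds that of i by ⟪g j - g i, v⟫ minus the gap at p i.
    -- The pairs are therefore (slope difference, gap).
    obtain ⟨Θ, h0, h1, h2, h3, h4⟩ := exists_modulus V hL
      (S := {z | ∃ i j, ‖p i‖ ≤ n ∧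
        z = (‖g i - g j‖, f i - (f j + ⟪g j, p i - p j⟫_ℝ))}) (by
        rintro _ ⟨i, j, -, rfl⟩
        exact ⟨(norm_sub_le _ _).trans (by linarith [hg i, hg j]), by linarith [hgap i j]⟩) (by
        intro η hη
        obtain ⟨δ, hδ, h⟩ := hmod n η hη
        refine ⟨δ, hδ, ?_⟩
        rintro _ ⟨i, j, hi, rfl⟩ hlt
        exact h i j hi hlt)
    refine ⟨Θ, h0, h1, h2, h3, fun i j hi v => ?_⟩
    have h5 := h4 _ ⟨i, j, hi, rfl⟩ v
    have h6 : ⟪g j - g i, v⟫_ℝ ≤ ‖g i - g j‖ * ‖v‖ := by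
      rw [norm_sub_rev]
      exact real_inner_le_norm _ _
    rw [inner_sub_left] at h6
    rw [add_sub_right_comm, inner_add_right]
    simp only at h5
    linarith
  choose Θ hΘ0 hΘlip hΘge hΘ2 hΘgap using hΘ
  set N : ι → ℕ := fun i => ⌈‖p i‖⌉₊ with hN
  have hNle : ∀ i, ‖p i‖ ≤ N i := fun i => Nat.le_ceil _
  -- One copy of Θ keeps q i above all affine functions of the family; the other makes it grow away
  -- from p i. The Lipschitz constant is L + 2 · 4L = 9L.
  set q : ι → V → ℝ := fun i x => f i + ⟪g i, x - p i⟫_ℝ + 2 * Θ (N i) (x - p i) with hq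
  have hΘnn : ∀ i v, 0 ≤ Θ (N i) v := by
    intro i v
    have := hΘgap (N i) i i (hNle i) v
    rw [add_sub_cancel_left] at this
    linarith
  have hqA : ∀ i j x, f j + ⟪g j, x - p j⟫_ℝ + 2 * L * (‖x - p i‖ - 1) ≤ q i x := by
    intro i j x
    have h1 := hΘgap (N i) i j (hNle i) (x - p i)
    rw [add_sub_cancel] at h1
    have h2 := hΘge (N i) (x - p i)
    simp only [hq]
    linarith
  have hqA' : ∀ i j x, f j + ⟪g j, x - p j⟫_ℝ ≤ q i x := by
    intro i j x
    have h1 := hΘgap (N i) i j (hNle i) (x - p i)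
    rw [add_sub_cancel] at h1
    have h2 := hΘnn i (x - p i)
    simp only [hq]
    linarith
  have hqlip : ∀ i x v, q i (x + v) ≤ q i x + 9 * L * ‖v‖ := by
    intro i x v
    have h1 := (abs_le.1 (hΘlip (N i) (x + v - p i) (x - p i))).2
    rw [sub_sub_sub_cancel_right, add_sub_cancel_left] at h1
    have h2 : ⟪g i, v⟫_ℝ ≤ L * ‖v‖ := (real_inner_le_norm _ _).trans (by gcongr; exact hg i)
    simp only [hq]
    rw [add_sub_right_comm x v, inner_add_right]
    rw [add_sub_right_comm x v] at h1
    linarith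
  set S : Set (V × ℝ) := {z | ∃ i, q i z.1 ≤ z.2} with hSdef
  have hA : ∀ j, ConvexOn ℝ Set.univ fun x => f j + ⟪g j, x - p j⟫_ℝ := by
    intro j
    refine ⟨convex_univ, fun x _ y _ s t _ _ hst => le_of_eq ?_⟩
    simp only [inner_sub_right, inner_add_right, real_inner_smul_right, smul_eq_mul]
    obtain rfl : t = 1 - s := by linarith
    ring
  have hAS : ∀ j, ∀ z ∈ S, f j + ⟪g j, z.1 - p j⟫_ℝ ≤ z.2 := by
    rintro j z ⟨i, hi⟩
    exact (hqA' i j z.1).trans hi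
  have j₀ : ι := Classical.arbitrary ι
  have hne : ∀ x, ∃ t, (x, t) ∈ S := fun x => ⟨q j₀ x, j₀, le_rfl⟩
  have hlow : ∀ j x, f j + ⟪g j, x - p j⟫_ℝ ≤ lowerHull S x := fun j x =>
    le_lowerHull (hA j) (hAS j) hne x
  have hconv := convexOn_lowerHull (hA j₀) (hAS j₀) hne
  have hlip : ∀ x y, |lowerHull S x - lowerHull S y| ≤ 9 * L * ‖x - y‖ :=
    abs_lowerHull_sub_le (hA j₀) (hAS j₀) hne (by
      rintro z ⟨i, hi⟩ v
      exact ⟨i, (hqlip i z.1 v).trans (by simpa using hi)⟩)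
  have hval : ∀ i, lowerHull S (p i) = f i := by
    intro i
    refine le_antisymm ?_ (by simpa using hlow i (p i))
    refine lowerHull_le (hA j₀) (hAS j₀) (subset_convexHull ℝ S ⟨i, ?_⟩)
    simp [hq, hΘ0]
  -- A bound on this height above l bounds both ‖z.1‖ and ‖z.1 - p i‖, hence ‖p i‖. So only finitely
  -- many of the Θ k are involved and they share a radius.
  set ψ : V × ℝ →ₗ[ℝ] ℝ := LinearMap.snd ℝ V ℝ - (innerₛₗ ℝ l).comp (LinearMap.fst ℝ V ℝ) with hψ
  have hψz : ∀ z, ψ z = z.2 - ⟪l, z.1⟫_ℝ := fun z => by simp [hψ]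
  have hψge : ∀ i z, q i z.1 ≤ z.2 →
      a * ‖z.1‖ + 2 * L * ‖z.1 - p i‖ - (b + 2 * L) ≤ ψ z := by
    intro i z hz
    obtain ⟨j, hj⟩ := hco z.1
    have := hqA i j z.1
    rw [hψz]
    linarith
  have hB : ∀ z ∈ S, -(b + 2 * L) ≤ ψ z := by
    rintro z ⟨i, hi⟩
    have := hψge i z hi
    have h1 : 0 ≤ a * ‖z.1‖ := by positivity
    have h2 : 0 ≤ 2 * L * ‖z.1 - p i‖ := by positivity
    linarith
  have hsecond := lowerHull_second_difference_le (hA j₀) (hAS j₀) hne hB (by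
    intro M ε hε
    set m := min a (2 * L) with hm
    have hm0 : 0 < m := lt_min ha (by positivity)
    set n := ⌈(M + (b + 2 * L)) / m⌉₊ with hn
    have hbound : ∀ i z, q i z.1 ≤ z.2 → ψ z < M → N i ≤ n := by
      intro i z hz hM
      have h1 := hψge i z hz
      have h2 : m * ‖z.1‖ ≤ a * ‖z.1‖ := by gcongr; exact min_le_left _ _
      have h3 : m * ‖z.1 - p i‖ ≤ 2 * L * ‖z.1 - p i‖ := by gcongr; exact min_le_right _ _
      have h4 : ‖p i‖ ≤ ‖z.1‖ + ‖z.1 - p i‖ := norm_le_norm_add_norm_sub _ _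
      refine Nat.ceil_mono ?_
      rw [le_div_iff₀ hm0]
      nlinarith
    have hev : ∀ k ∈ Finset.range (n + 1), ∀ᶠ r : ℝ in 𝓝[>] 0, ∀ v h : V, ‖h‖ ≤ r →
        Θ k (v + h) + Θ k (v - h) - 2 * Θ k v ≤ ε / 2 * ‖h‖ := by
      intro k _
      obtain ⟨r, hr, h⟩ := hΘ2 k (ε / 2) (by positivity)
      filter_upwards [Ioo_mem_nhdsGT hr] with s hs v h' hh'
      exact h v h' (hh'.trans hs.2.le)
    obtain ⟨r, hr1, hr2⟩ := (((Filter.eventually_all_finset _).2 hev).and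
      self_mem_nhdsWithin).exists
    refine ⟨r, hr2, ?_⟩
    rintro z ⟨i, hi⟩ hM v hv
    refine ⟨q i (z.1 + v) - q i z.1, ⟨i, by simp only; linarith⟩, ⟨i, ?_⟩⟩
    have h1 := hr1 (N i) (Finset.mem_range_succ_iff.2 (hbound i z hi hM)) (z.1 - p i) v hv
    simp only [hq] at hi ⊢
    rw [add_sub_right_comm z.1 v, sub_right_comm z.1 v, inner_add_right,
      inner_sub_right (g i) (z.1 - p i) v]
    linarith)
  choose ξ hξ using fun x => hconv.exists_subgradient
    (LipschitzWith.of_dist_le_mul (K := ⟨9 * L, by positivity⟩) (fun x y => by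
      rw [Real.dist_eq, dist_eq_norm]
      exact hlip x y)).continuous x
  have hgrad : ∀ x, HasGradientAt (lowerHull S) (ξ x) x := fun x =>
    hasGradientAt_of_subgradient (hξ x) (hsecond x)
  refine ⟨lowerHull S, hconv, hlip, hconv.contDiff_one_of_hasGradientAt hlip hgrad, hval,
    fun i => ?_, fun x => ?_⟩
  · rw [← (hgrad (p i)).eq_of_subgradient (η := g i) fun y => by rw [hval]; exact hlow i y]
    exact hgrad (p i)
  · obtain ⟨i, hi⟩ := hco x
    exact hi.trans (hlow i x)

/-! ### Linear growth along the span of slope differences, and additional jets. -/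

/-- The span of all differences of a family of vectors. -/
def differenceSpan {W ι : Type*} [AddCommGroup W] [Module ℝ W] (g : ι → W) : Submodule ℝ W :=
  Submodule.span ℝ {v | ∃ i j, v = g i - g j}

theorem sub_mem_differenceSpan {W ι : Type*} [AddCommGroup W] [Module ℝ W] (g : ι → W)
    (i j : ι) : g i - g j ∈ differenceSpan g :=
  Submodule.subset_span ⟨i, j, rfl⟩

section FiniteDimensional

variable {W : Type*} [NormedAddCommGroup W] [InnerProductSpace ℝ W] [FiniteDimensional ℝ W]

/-- Pairing with the spanning vectors is injective on Y, hence bounded below in finite dimension. -/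
theorem exists_norm_le_of_span_range_eq {m : ℕ} {Y : Submodule ℝ W} {h : Fin m → W}
    (hY : Submodule.span ℝ (Set.range h) = Y) :
    ∃ K : ℝ, 0 < K ∧ ∀ (x : W) (M : ℝ), 0 ≤ M → (∀ k, |⟪h k, x⟫_ℝ| ≤ M) →
      ‖Y.orthogonalProjectionOnto x‖ ≤ K * M := by
  set Λ : Y →ₗ[ℝ] (Fin m → ℝ) := LinearMap.pi fun k => (innerₛₗ ℝ (h k)).comp Y.subtype with hΛ
  have hΛk : ∀ y k, Λ y k = ⟪h k, (y : W)⟫_ℝ := fun y k => by simp [hΛ]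
  have hker : LinearMap.ker Λ = ⊥ := by
    rw [LinearMap.ker_eq_bot']
    intro y hy
    have h1 : (y : W) ∈ Yᗮ := by
      rw [Submodule.mem_orthogonal]
      intro u hu
      replace hu : u ∈ Submodule.span ℝ (Set.range h) := hY ▸ hu
      induction hu using Submodule.span_induction with
      | mem u hu =>
        obtain ⟨k, rfl⟩ := hu
        rw [← hΛk, hy]
        rfl
      | zero => simp
      | add u v _ _ hu hv => rw [inner_add_left, hu, hv, add_zero]
      | smul c u _ hu => rw [real_inner_smul_left, hu, mul_zero]
    have h2 := Submodule.inner_right_of_mem_orthogonal y.2 h1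
    exact Subtype.ext (inner_self_eq_zero.1 h2)
  obtain ⟨K, hK, hanti⟩ := Λ.exists_antilipschitzWith hker
  refine ⟨K, hK, fun x M hM hx => ?_⟩
  have h1 := hanti.le_mul_dist (Y.orthogonalProjectionOnto x) 0
  rw [map_zero, dist_zero_right, dist_zero_right] at h1
  refine h1.trans (mul_le_mul_of_nonneg_left ?_ hK.le)
  rw [pi_norm_le_iff_of_nonneg hM]
  intro k
  have hk : h k ∈ Y := hY ▸ Submodule.subset_span ⟨k, rfl⟩
  rw [hΛk, Submodule.coe_orthogonalProjectionOnto_apply,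
    ← Submodule.inner_starProjection_left_eq_right,
    Submodule.starProjection_eq_self_iff.2 hk]
  exact hx k

/-- Finitely many members of a family detect the orthogonal projection to the span of its
differences. -/
theorem exists_coercive_slope {ι : Type*} [Nonempty ι] {g : ι → W} {L : ℝ}
    (hg : ∀ i, ‖g i‖ ≤ L) :
    ∃ (T : Finset ι) (l : W) (a : ℝ), 0 < a ∧ ‖l‖ ≤ L ∧ (∀ i, g i - l ∈ differenceSpan g) ∧
      ∀ x, ∃ i ∈ T, a * ‖(differenceSpan g).orthogonalProjectionOnto x‖ ≤ ⟪g i - l, x⟫_ℝ := by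
  classical
  obtain ⟨h, hmem, hspan, -⟩ := Submodule.exists_fun_fin_finrank_span_eq ℝ
    {v | ∃ i j, v = g i - g j}
  choose i j hij using hmem
  obtain ⟨K, hK, hproj⟩ := exists_norm_le_of_span_range_eq hspan
  set i₀ : ι := Classical.arbitrary ι
  set T : Finset ι := insert i₀ (Finset.univ.image i ∪ Finset.univ.image j) with hT
  have hTi : ∀ k, i k ∈ T := fun k => by simp [hT]
  have hTj : ∀ k, j k ∈ T := fun k => by simp [hT]
  have hTne : T.Nonempty := ⟨i₀, by simp [hT]⟩
  set N : ℝ := (T.card : ℝ) with hN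
  have hN0 : 0 < N := by
    rw [hN]
    exact_mod_cast hTne.card_pos
  -- For the mean l the numbers ⟪g k - l, x⟫ sum to zero, so their maximum M bounds them all in
  -- absolute value by N M. The differences g (i k) - g (j k) then pair with x to at most 2 N M,
  -- which controls the projection.
  set l : W := N⁻¹ • ∑ k ∈ T, g k with hl
  have hNl : ∀ u : W, ∑ k ∈ T, (g k - u) = N • (l - u) := by
    intro u
    rw [Finset.sum_sub_distrib, Finset.sum_const, smul_sub, hl, smul_inv_smul₀ hN0.ne', hN,
      Nat.cast_smul_eq_nsmul]
  refine ⟨T, l, (2 * N * K)⁻¹, by positivity, ?_, fun k => ?_, fun x => ?_⟩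
  · rw [hl, norm_smul, Real.norm_of_nonneg (by positivity), inv_mul_le_iff₀ hN0]
    refine (norm_sum_le _ _).trans ?_
    refine (Finset.sum_le_card_nsmul T _ L fun k _ => hg k).trans ?_
    rw [nsmul_eq_mul]
  · have h1 : g k - l = -(N⁻¹ • ∑ m ∈ T, (g m - g k)) := by
      rw [hNl, inv_smul_smul₀ hN0.ne', neg_sub]
    rw [h1]
    exact neg_mem (Submodule.smul_mem _ _ (Submodule.sum_mem _ fun m _ =>
      sub_mem_differenceSpan g m k))
  · obtain ⟨m, hm, hmax⟩ := T.exists_max_image (fun k => ⟪g k - l, x⟫_ℝ) hTne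
    refine ⟨m, hm, ?_⟩
    set M := ⟪g m - l, x⟫_ℝ with hM
    have hsum : ∑ k ∈ T, ⟪g k - l, x⟫_ℝ = 0 := by
      rw [← sum_inner, hNl, sub_self, smul_zero, inner_zero_left]
    have hM0 : 0 ≤ M := by
      have h1 := Finset.sum_le_card_nsmul T _ M hmax
      rw [hsum, nsmul_eq_mul] at h1
      exact nonneg_of_mul_nonneg_right h1 hN0
    have hlow : ∀ k ∈ T, -(N * M) ≤ ⟪g k - l, x⟫_ℝ := by
      intro k hk
      have h1 : ∑ k ∈ T, (M - ⟪g k - l, x⟫_ℝ) = N * M := by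
        rw [Finset.sum_sub_distrib, hsum, Finset.sum_const, nsmul_eq_mul, sub_zero]
      have h2 := Finset.single_le_sum (f := fun k => M - ⟪g k - l, x⟫_ℝ)
        (fun k hk => sub_nonneg.2 (hmax k hk)) hk
      simp only [h1] at h2
      linarith
    have hN1 : 1 ≤ N := by
      rw [hN]
      exact_mod_cast hTne.card_pos
    have hup : ∀ k ∈ T, ⟪g k - l, x⟫_ℝ ≤ N * M := fun k hk =>
      (hmax k hk).trans (by nlinarith)
    have h3 := hproj x (2 * N * M) (by positivity) fun k => by
      have h4 : h k = (g (i k) - l) - (g (j k) - l) := by rw [hij k]; abel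
      rw [h4, inner_sub_left, abs_le]
      have := hlow _ (hTi k)
      have := hlow _ (hTj k)
      have := hup _ (hTi k)
      have := hup _ (hTj k)
      constructor <;> linarith
    rw [inv_mul_le_iff₀ (by positivity)]
    refine h3.trans (le_of_eq ?_)
    ring

/-- The maximal affine minorant of a family of 1-jets grows linearly along the span of the
differences of the slopes. -/
theorem exists_coercive_lower_bound {ι : Type*} [Nonempty ι] {g : ι → W} {L : ℝ}
    (hg : ∀ i, ‖g i‖ ≤ L) (p : ι → W) (f : ι → ℝ) :
    ∃ (l : W) (a b : ℝ), 0 < a ∧ ‖l‖ ≤ L ∧ (∀ i, g i - l ∈ differenceSpan g) ∧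
      ∀ x, ∃ i, ⟪l, x⟫_ℝ + a * ‖(differenceSpan g).orthogonalProjectionOnto x‖ - b ≤
        f i + ⟪g i, x - p i⟫_ℝ := by
  obtain ⟨T, l, a, ha, hl, hmem, hT⟩ := exists_coercive_slope hg
  refine ⟨l, a, ∑ i ∈ T, |f i - ⟪g i, p i⟫_ℝ|, ha, hl, hmem, fun x => ?_⟩
  obtain ⟨i, hi, h⟩ := hT x
  refine ⟨i, ?_⟩
  have h1 := Finset.single_le_sum (f := fun i => |f i - ⟪g i, p i⟫_ℝ|)
    (fun k _ => abs_nonneg _) hi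
  have h2 := neg_abs_le (f i - ⟪g i, p i⟫_ℝ)
  rw [inner_sub_left] at h
  rw [inner_sub_right]
  linarith

/-- If the positions of a family of convex 1-jets avoid the given cones, one jet can be added in
every cone so that the slopes span the additional directions. -/
theorem exists_additional_jets {ι κ : Type*} [Nonempty ι] [Fintype κ] {p : ι → W} {f : ι → ℝ}
    {g : ι → W} {L : ℝ} (hL : 0 < L) (hg : ∀ i, ‖g i‖ ≤ L)
    (hgap : ∀ i j, f j + ⟪g j, p i - p j⟫_ℝ ≤ f i) {w c : κ → W} {ε : ℝ} (hε : 0 < ε)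
    (hε1 : ε ≤ 1) (hw1 : ∀ k, ‖w k‖ = 1) (hwinj : Function.Injective w)
    (hwY : ∀ k, w k ∈ (differenceSpan g)ᗮ)
    (hcone : ∀ k i, ε * ⟪w k, p i - c k⟫_ℝ <
      ‖(differenceSpan g).orthogonalProjectionOnto (p i - c k)‖) :
    ∃ (p' : κ → W) (f' : κ → ℝ) (g' : κ → W), (∀ k, ‖g' k‖ ≤ 2 * L) ∧
      (∀ i k, f' k + ⟪g' k, p i - p' k⟫_ℝ + 1 ≤ f i) ∧
      (∀ k i, f i + ⟪g i, p' k - p i⟫_ℝ + 1 ≤ f' k) ∧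
      (∀ k m, k ≠ m → f' m + ⟪g' m, p' k - p' m⟫_ℝ + 1 ≤ f' k) ∧
      differenceSpan (Sum.elim g g') = differenceSpan g ⊔ Submodule.span ℝ (Set.range w) := by
  obtain ⟨l, a₀, b, ha₀, hl, hlg, hco⟩ := exists_coercive_lower_bound hg p f
  set Y := differenceSpan g with hY
  set a := min a₀ L with ha
  have ha0 : 0 < a := lt_min ha₀ hL
  -- The new slopes are l + s • w k. Outside the cone, s⟪w k, x - c k⟫ < a‖P_Y (x - c k)‖, which the
  -- coercive bound absorbs. The constant B pays for the offset c k and the gap 1, and a ≤ L keeps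
  -- the new slopes below 2L.
  set s := a * ε with hs
  have hs0 : 0 < s := mul_pos ha0 hε
  have hsL : s ≤ L := by
    have : a ≤ L := min_le_right _ _
    nlinarith
  set B := b + 1 + a * ∑ k, ‖c k‖ with hB
  have hck : ∀ k, ‖c k‖ ≤ ∑ k, ‖c k‖ := fun k =>
    Finset.single_le_sum (f := fun k => ‖c k‖) (fun k _ => norm_nonneg _) (Finset.mem_univ k)
  set i₀ : ι := Classical.arbitrary ι
  have hlarge : ∀ r D : ℝ, 0 < r → ∀ᶠ t : ℝ in atTop, D ≤ r * t := fun r D hr =>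
    (tendsto_id.const_mul_atTop hr).eventually_ge_atTop D
  have hww : ∀ k m, k ≠ m → 0 < s * (1 - ⟪w m, w k⟫_ℝ) := by
    intro k m hkm
    have : ⟪w m, w k⟫_ℝ < 1 :=
      (inner_lt_one_iff_real_of_norm_eq_one (hw1 m) (hw1 k)).2 fun h => hkm (hwinj h.symm)
    exact mul_pos hs0 (by linarith)
  have hev1 : ∀ᶠ t : ℝ in atTop, ∀ k,
      f i₀ + L * ‖c k - p i₀‖ - ⟪l, c k⟫_ℝ + B + 1 ≤ s * t :=
    eventually_all.2 fun k => hlarge _ _ hs0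
  have hev2 : ∀ᶠ t : ℝ in atTop, ∀ k m, k ≠ m →
      1 + s * ⟪w m, c k - c m⟫_ℝ ≤ s * (1 - ⟪w m, w k⟫_ℝ) * t := by
    refine eventually_all.2 fun k => eventually_all.2 fun m => ?_
    by_cases hkm : k = m
    · simp [hkm]
    · filter_upwards [hlarge _ (1 + s * ⟪w m, c k - c m⟫_ℝ) (hww k m hkm)] with t ht _ using ht
  -- Far out along w k the new jet dominates: every old slope has the same component as l along w k,
  -- since g i - l ∈ Y, and the other new ones grow more slowly because ⟪w m, w k⟫ < 1.
  obtain ⟨t, ht1, ht2⟩ := (hev1.and hev2).exists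
  set p' : κ → W := fun k => c k + t • w k with hp'
  set g' : κ → W := fun k => l + s • w k with hg'
  have hwself : ∀ k, ⟪w k, w k⟫_ℝ = 1 := fun k => by
    rw [real_inner_self_eq_norm_sq, hw1, one_pow]
  have hplane : ∀ k x, ⟪l, p' k⟫_ℝ + s * t - B + ⟪g' k, x - p' k⟫_ℝ =
      ⟪l, x⟫_ℝ + s * ⟪w k, x - c k⟫_ℝ - B := by
    intro k x
    simp only [hp', hg', inner_add_left, inner_sub_right, inner_add_right, real_inner_smul_left,
      real_inner_smul_right, hwself]
    ring
  refine ⟨p', fun k => ⟪l, p' k⟫_ℝ + s * t - B, g', fun k => ?_, fun i k => ?_, fun k i => ?_,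
    fun k m hkm => ?_, le_antisymm ?_ ?_⟩
  · refine (norm_add_le _ _).trans ?_
    rw [norm_smul, hw1, Real.norm_of_nonneg hs0.le]
    linarith
  · rw [hplane]
    obtain ⟨j, hj⟩ := hco (p i)
    have h1 := hgap i j
    have h2 : ‖Y.orthogonalProjectionOnto (p i - c k)‖ ≤
        ‖Y.orthogonalProjectionOnto (p i)‖ + ‖c k‖ := by
      rw [map_sub]
      exact (norm_sub_le _ _).trans (by gcongr; exact Y.norm_orthogonalProjectionOnto_apply_le _)
    have h3 : s * ⟪w k, p i - c k⟫_ℝ ≤ a * (‖Y.orthogonalProjectionOnto (p i)‖ + ‖c k‖) := by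
      rw [hs, mul_assoc]
      exact mul_le_mul_of_nonneg_left ((hcone k i).le.trans h2) ha0.le
    have h4 : a * ‖Y.orthogonalProjectionOnto (p i)‖ ≤
        a₀ * ‖Y.orthogonalProjectionOnto (p i)‖ := by
      gcongr
      exact min_le_left _ _
    have h5 : a * ‖c k‖ ≤ a * ∑ k, ‖c k‖ := by
      gcongr
      exact hck k
    linarith
  · have h1 : ⟪g i, w k⟫_ℝ = ⟪l, w k⟫_ℝ := by
      have := Submodule.inner_right_of_mem_orthogonal (hlg i) (hwY k)
      rw [inner_sub_left] at this
      linarith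
    have h2 : ⟪g i, c k - p i₀⟫_ℝ ≤ L * ‖c k - p i₀‖ :=
      (real_inner_le_norm _ _).trans (by gcongr; exact hg i)
    have h3 := hgap i₀ i
    have h4 := ht1 k
    simp only [hp', inner_sub_right, inner_add_right, real_inner_smul_right, h1] at h2 h3 h4 ⊢
    linarith
  · rw [hplane]
    have h1 := ht2 k m hkm
    simp only [hp', inner_sub_right, inner_add_right, real_inner_smul_right] at h1 ⊢
    linarith
  · refine Submodule.span_le.2 ?_
    have hbase : ∀ z, Sum.elim g g' z - l ∈ Y ⊔ Submodule.span ℝ (Set.range w) := by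
      rintro (i | k)
      · exact Submodule.mem_sup_left (hlg i)
      · simp only [Sum.elim_inr, hg', add_sub_cancel_left]
        exact Submodule.mem_sup_right (Submodule.smul_mem _ _ (Submodule.subset_span ⟨k, rfl⟩))
    rintro _ ⟨y, z, rfl⟩
    rw [← sub_sub_sub_cancel_right _ _ l]
    exact sub_mem (hbase y) (hbase z)
  · have hYle : Y ≤ differenceSpan (Sum.elim g g') := by
      refine Submodule.span_le.2 ?_
      rintro _ ⟨i, j, rfl⟩
      exact sub_mem_differenceSpan (Sum.elim g g') (Sum.inl i) (Sum.inl j)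
    refine sup_le hYle (Submodule.span_le.2 ?_)
    rintro _ ⟨k, rfl⟩
    have h1 : w k = s⁻¹ • ((g' k - g i₀) + (g i₀ - l)) := by
      simp only [hg', sub_add_sub_cancel, add_sub_cancel_left, inv_smul_smul₀ hs0.ne']
    rw [SetLike.mem_coe, h1]
    exact Submodule.smul_mem _ _ (add_mem
      (sub_mem_differenceSpan (Sum.elim g g') (Sum.inr k) (Sum.inl i₀)) (hYle (hlg i₀)))

end FiniteDimensional

/-! ### Pulling back from X to the whole space. -/

theorem essentiallyCoercive_of_le {Z : Type*} [NormedAddCommGroup Z] [InnerProductSpace ℝ Z]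
    {c : Z → ℝ} {l : Z} {a b : ℝ} (ha : 0 < a) (h : ∀ x, ⟪l, x⟫_ℝ + a * ‖x‖ - b ≤ c x) :
    EssentiallyCoercive c := by
  refine ⟨innerₛₗ ℝ l, ?_⟩
  have h1 : Tendsto (fun x : Z => a * ‖x‖ - b) (Bornology.cobounded Z) atTop :=
    tendsto_atTop_add_const_right _ _ (tendsto_norm_cobounded_atTop.const_mul_atTop ha)
  refine tendsto_atTop_mono (fun x => ?_) h1
  have := h x
  simp only [innerₛₗ_apply_apply]
  linarith

section Pullback

variable {W : Type*} [NormedAddCommGroup W] [InnerProductSpace ℝ W] [FiniteDimensional ℝ W]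
  {X : Submodule ℝ W} {c : X → ℝ}

theorem ConvexOn.pullback_add_inner (hc : ConvexOn ℝ Set.univ c) (v : W) :
    ConvexOn ℝ Set.univ fun x => c (X.orthogonalProjectionOnto x) + ⟪v, x⟫_ℝ := by
  have h1 : ConvexOn ℝ Set.univ fun x => c (X.orthogonalProjectionOnto x) := by
    have := hc.comp_linearMap X.orthogonalProjectionOnto.toLinearMap
    simpa [Function.comp_def] using this
  have h2 : ConvexOn ℝ Set.univ fun x : W => ⟪v, x⟫_ℝ := by
    simpa using (innerₛₗ ℝ v).convexOn convex_univ
  exact h1.add h2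

theorem ContDiff.pullback_add_inner (hc : ContDiff ℝ 1 c) (v : W) :
    ContDiff ℝ 1 fun x => c (X.orthogonalProjectionOnto x) + ⟪v, x⟫_ℝ :=
  (hc.comp X.orthogonalProjectionOnto.contDiff).add (innerSL ℝ v).contDiff

theorem abs_pullback_add_inner_sub_le {K : ℝ} (hK : 0 ≤ K)
    (hc : ∀ x y, |c x - c y| ≤ K * ‖x - y‖) (v x y : W) :
    |c (X.orthogonalProjectionOnto x) + ⟪v, x⟫_ℝ -
      (c (X.orthogonalProjectionOnto y) + ⟪v, y⟫_ℝ)| ≤ (K + ‖v‖) * ‖x - y‖ := by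
  have h1 := hc (X.orthogonalProjectionOnto x) (X.orthogonalProjectionOnto y)
  rw [← map_sub] at h1
  have h2 : K * ‖X.orthogonalProjectionOnto (x - y)‖ ≤ K * ‖x - y‖ := by
    gcongr
    exact X.norm_orthogonalProjectionOnto_apply_le _
  have h3 := abs_real_inner_le_norm v (x - y)
  rw [inner_sub_right] at h3
  rw [add_sub_add_comm]
  refine (abs_add_le _ _).trans ?_
  linarith

theorem HasGradientAt.pullback_add_inner {x : W} {ξ : X}
    (hc : HasGradientAt c ξ (X.orthogonalProjectionOnto x)) (v : W) :
    HasGradientAt (fun x => c (X.orthogonalProjectionOnto x) + ⟪v, x⟫_ℝ) (ξ + v) x := by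
  rw [hasGradientAt_iff_hasFDerivAt] at hc ⊢
  have h1 := (hc.comp x X.orthogonalProjectionOnto.hasFDerivAt).add
    (innerSL ℝ v).hasFDerivAt (x := x)
  have h2 : InnerProductSpace.toDual ℝ W (ξ + v) =
      (InnerProductSpace.toDual ℝ X ξ).comp X.orthogonalProjectionOnto + innerSL ℝ v := by
    ext y
    simp
  rw [h2]
  exact h1

end Pullback

/-- Extension of a family of convex 1-jets whose slopes span a translate of `X`. -/
theorem exists_extension_of_differenceSpan_eq {W : Type*} [NormedAddCommGroup W]
    [InnerProductSpace ℝ W] [FiniteDimensional ℝ W] {ι : Type*} [Nonempty ι] {p : ι → W}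
    {f : ι → ℝ} {g : ι → W} {L : ℝ} (hL : 0 < L) (hg : ∀ i, ‖g i‖ ≤ L)
    (hgap : ∀ i j, f j + ⟪g j, p i - p j⟫_ℝ ≤ f i) {X : Submodule ℝ W}
    (hX : differenceSpan g = X)
    (hmod : ∀ R, ∀ η > 0, ∃ δ > 0, ∀ i j, ‖X.orthogonalProjectionOnto (p i)‖ ≤ R →
      f i - (f j + ⟪g j, p i - p j⟫_ℝ) < δ → ‖g i - g j‖ < η) :
    ∃ F : W → ℝ, ConvexOn ℝ Set.univ F ∧ (∀ x y, |F x - F y| ≤ 10 * L * ‖x - y‖) ∧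
      ContDiff ℝ 1 F ∧ (∀ i, F (p i) = f i) ∧ (∀ i, HasGradientAt F (g i) (p i)) ∧
      ∃ v ∈ Xᗮ, ∃ c : X → ℝ, EssentiallyCoercive c ∧
        ∀ x, F x = c (X.orthogonalProjectionOnto x) + ⟪v, x⟫_ℝ := by
  obtain ⟨l, a, b, ha, -, -, hco⟩ := exists_coercive_lower_bound hg p f
  rw [hX] at hco
  set P := X.orthogonalProjectionOnto with hP
  set i₀ : ι := Classical.arbitrary ι
  -- All slopes share the component v in Xᗮ. Subtracting ⟪v, ·⟫ yields jets on X with the same gaps;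
  -- adding it back costs ‖v‖ ≤ L in the Lipschitz constant, whence 9L + L.
  set v : W := g i₀ - P (g i₀) with hv
  have hvX : v ∈ Xᗮ := X.sub_starProjection_mem_orthogonal (g i₀)
  have hgv : ∀ i, (P (g i) : W) + v = g i := by
    intro i
    have h1 : g i - g i₀ ∈ X := hX ▸ sub_mem_differenceSpan g i i₀
    have h2 : (P (g i - g i₀) : W) = g i - g i₀ := X.starProjection_eq_self_iff.2 h1
    rw [map_sub, Submodule.coe_sub] at h2
    rw [hv, ← add_sub_assoc, add_sub_right_comm, h2, sub_add_cancel]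
  have hinner : ∀ i x, ⟪P (g i), P x⟫_ℝ = ⟪g i, x⟫_ℝ - ⟪v, x⟫_ℝ := by
    intro i x
    rw [Submodule.inner_orthogonalProjectionOnto_eq_of_mem_left, ← inner_sub_left,
      ← eq_sub_of_add_eq (hgv i)]
  have hgap' : ∀ i j, (f j - ⟪v, p j⟫_ℝ) + ⟪P (g j), P (p i) - P (p j)⟫_ℝ =
      f j + ⟪g j, p i - p j⟫_ℝ - ⟪v, p i⟫_ℝ := by
    intro i j
    rw [← map_sub, hinner, inner_sub_right v]
    ring
  obtain ⟨c, hc1, hc2, hc3, hc4, hc5, hc6⟩ := exists_coercive_extension (p := fun i => P (p i))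
    (f := fun i => f i - ⟪v, p i⟫_ℝ) (g := fun i => P (g i)) (l := P l) (b := b) hL
    (fun i => (X.norm_orthogonalProjectionOnto_apply_le _).trans (hg i))
    (fun i j => by
      rw [hgap']
      linarith [hgap i j])
    (fun R η hη => by
      obtain ⟨δ, hδ, h⟩ := hmod R η hη
      refine ⟨δ, hδ, fun i j hi hij => ?_⟩
      rw [hgap'] at hij
      rw [← map_sub]
      exact (X.norm_orthogonalProjectionOnto_apply_le _).trans_lt (h i j hi (by linarith)))
    ha
    (fun x => by
      obtain ⟨i, hi⟩ := hco x
      refine ⟨i, ?_⟩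
      have h1 : P (x : W) = x := Submodule.orthogonalProjectionOnto_mem_subspace_eq_self x
      have h2 := hinner i x
      have h3 : ⟪P l, x⟫_ℝ = ⟪l, (x : W)⟫_ℝ := by
        rw [Submodule.inner_orthogonalProjectionOnto_eq_of_mem_right]
      have h4 : ⟪v, (x : W)⟫_ℝ = 0 := Submodule.inner_left_of_mem_orthogonal x.2 hvX
      rw [h1] at h2 hi
      rw [inner_sub_right, h2, hinner, h3]
      rw [inner_sub_right] at hi
      linarith)
  have hvL : ‖v‖ ≤ L := by
    have h1 : v = (Xᗮ).starProjection (g i₀) := by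
      rw [Submodule.starProjection_orthogonal']
      rfl
    rw [h1]
    exact ((Xᗮ).norm_starProjection_apply_le _).trans (hg i₀)
  refine ⟨fun x => c (P x) + ⟪v, x⟫_ℝ, hc1.pullback_add_inner v, fun x y => ?_,
    hc3.pullback_add_inner v, fun i => ?_, fun i => ?_, v, hvX, c,
    essentiallyCoercive_of_le ha hc6, fun x => rfl⟩
  · refine (abs_pullback_add_inner_sub_le (by positivity) hc2 v x y).trans ?_
    gcongr
    linarith
  · simp only [hc4]
    ring
  · have := (hc5 i).pullback_add_inner v
    rwa [hgv] at this

/-! ### Sufficiency of the conditions. -/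

section Euclidean

variable {n : ℕ} {E : Set (EuclideanSpace ℝ (Fin n))} {X : Submodule ℝ (EuclideanSpace ℝ (Fin n))}
  {f : E → ℝ} {G : E → EuclideanSpace ℝ (Fin n)}

theorem LipschitzJetConditions.exists_modulus (h : LipschitzJetConditions X f G) (R η : ℝ)
    (hη : 0 < η) : ∃ δ > 0, ∀ x y : E,
      ‖X.orthogonalProjectionOnto (x : EuclideanSpace ℝ (Fin n))‖ ≤ R →
      f x - (f y + ⟪G y, (x : EuclideanSpace ℝ (Fin n)) - y⟫_ℝ) < δ → ‖G x - G y‖ < η := by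
  by_contra! hcon
  choose x y hx hxy hG using fun k : ℕ => hcon (1 / ((k : ℝ) + 1)) (by positivity)
  have h1 := h.sequences x y (isBounded_iff_forall_norm_le.2 ⟨R, by
    rintro _ ⟨k, rfl⟩
    exact hx k⟩) (squeeze_zero (fun k => by linarith [h.basic.2.2 (x k) (y k)])
      (fun k => by linarith [hxy k]) tendsto_one_div_add_atTop_nhds_zero_nat)
  obtain ⟨k, hk⟩ := (h1.eventually (gt_mem_nhds hη)).exists
  exact absurd hk (not_lt.2 (hG k))

/-- By dimension count the w k span X ⊓ Yᗮ. The case Y = X is covered by the empty family. -/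
theorem LipschitzJetConditions.exists_cones (h : LipschitzJetConditions X f G) :
    ∃ (m : ℕ) (w c : Fin m → EuclideanSpace ℝ (Fin n)) (ε : ℝ), 0 < ε ∧ ε ≤ 1 ∧
      (∀ k, ‖w k‖ = 1) ∧ Function.Injective w ∧ (∀ k, w k ∈ (jetSpan G)ᗮ) ∧
      (∀ k (x : E), ε * ⟪w k, x - c k⟫_ℝ < ‖(jetSpan G).orthogonalProjectionOnto (x - c k)‖) ∧
      jetSpan G ⊔ Submodule.span ℝ (Set.range w) = X := by
  by_cases hY : jetSpan G = X
  · exact ⟨0, Fin.elim0, Fin.elim0, 1, one_pos, le_rfl, fun k => k.elim0, fun k => k.elim0,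
      fun k => k.elim0, fun k => k.elim0, by simp [hY]⟩
  obtain ⟨c, ε, w, -, hε0, hε1, hli, hw1, hwX, hcone⟩ := h.cones hY
  refine ⟨_, w, c, ε, hε0, hε1.le, hw1, hli.injective, fun k => (hwX k).2,
    fun k x => not_le.1 (hcone k x (subset_closure x.2)), ?_⟩
  have hle : Submodule.span ℝ (Set.range w) ≤ (jetSpan G)ᗮ ⊓ X := by
    refine Submodule.span_le.2 ?_
    rintro _ ⟨k, rfl⟩
    exact ⟨(hwX k).2, (hwX k).1⟩
  have hrank := Submodule.finrank_add_inf_finrank_orthogonal h.span_le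
  have heq := Submodule.eq_of_le_of_finrank_eq hle (by
    rw [finrank_span_eq_card hli, Fintype.card_fin]
    omega)
  rw [heq, Submodule.sup_orthogonal_inf_of_hasOrthogonalProjection h.span_le]

theorem LipschitzJetConditions.exists_extension [Nonempty E] (h : LipschitzJetConditions X f G)
    {L : ℝ} (hL : 0 < L) (hG : ∀ x, ‖G x‖ ≤ L) :
    ∃ F : EuclideanSpace ℝ (Fin n) → ℝ, IsLipschitzConvexExtension X f G F ∧
      ∀ x y, |F x - F y| ≤ 20 * L * ‖x - y‖ := by
  obtain ⟨m, w, c, ε, hε0, hε1, hw1, hwinj, hwY, hcone, hspan⟩ := h.exists_cones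
  obtain ⟨p', f', g', hg', hgap1, hgap2, hgap3, hspan'⟩ :=
    exists_additional_jets (p := fun x : E => (x : EuclideanSpace ℝ (Fin n))) hL hG
      h.basic.2.2 hε0 hε1 hw1 hwinj hwY hcone
  obtain ⟨F, hF1, hF2, hF3, hF4, hF5, hF6⟩ := exists_extension_of_differenceSpan_eq
    (p := Sum.elim (fun x : E => (x : EuclideanSpace ℝ (Fin n))) p') (f := Sum.elim f f')
    (g := Sum.elim G g') (L := 2 * L) (X := X) (by positivity) (by
      rintro (x | k)
      · exact (hG x).trans (by linarith)
      · exact hg' k) (by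
      rintro (x | k) (y | m)
      · exact h.basic.2.2 x y
      · simp only [Sum.elim_inl, Sum.elim_inr]
        linarith [hgap1 x m]
      · simp only [Sum.elim_inl, Sum.elim_inr]
        linarith [hgap2 k y]
      · by_cases hkm : k = m
        · simp [hkm]
        · simp only [Sum.elim_inr]
          linarith [hgap3 k m hkm]) (hspan'.trans hspan) (by
      intro R η hη
      obtain ⟨δ, hδ, hmod⟩ := h.exists_modulus R η hη
      -- A gap below 1 occurs only between two original jets or between an added jet and itself.
      refine ⟨min δ 1, lt_min hδ one_pos, ?_⟩
      rintro (x | k) (y | m) hR hlt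
      · exact hmod x y hR (hlt.trans_le (min_le_left _ _))
      · have := hlt.trans_le (min_le_right _ _)
        simp only [Sum.elim_inl, Sum.elim_inr] at this
        linarith [hgap1 x m]
      · have := hlt.trans_le (min_le_right _ _)
        simp only [Sum.elim_inl, Sum.elim_inr] at this
        linarith [hgap2 k y]
      · by_cases hkm : k = m
        · simpa [hkm] using hη
        · have := hlt.trans_le (min_le_right _ _)
          simp only [Sum.elim_inr] at this
          linarith [hgap3 k m hkm])
  have hlip : ∀ x y, |F x - F y| ≤ 20 * L * ‖x - y‖ := fun x y => by
    have := hF2 x y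
    linarith
  refine ⟨F, ⟨⟨⟨20 * L, by positivity⟩, LipschitzWith.of_dist_le_mul fun x y => ?_⟩, hF1, hF3,
    fun x => hF4 (Sum.inl x), fun x => (hF5 (Sum.inl x)).gradient, hF6⟩, hlip⟩
  rw [Real.dist_eq, dist_eq_norm]
  exact hlip x y

/-- Without data, `√(1 + |P_X x|²) - 1` is an extension. -/
theorem exists_extension_of_isEmpty [IsEmpty E] :
    ∃ F : EuclideanSpace ℝ (Fin n) → ℝ, IsLipschitzConvexExtension X f G F ∧
      (X = ⊥ → ∀ x y, F x = F y) := by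
  set c : X → ℝ := smoothNorm 1 with hc
  have hlip : ∀ x y : X, |c x - c y| ≤ 1 * ‖x - y‖ := fun x y => by
    rw [one_mul]
    exact abs_smoothNorm_sub_le x y
  have hconv : ConvexOn ℝ Set.univ c := by
    refine ⟨convex_univ, fun x _ y _ a b ha hb hab => ?_⟩
    -- Convexity follows from the triangle inequality for the vectors (1, z) in the Hilbert sum ℝ ⊕
    -- X.
    have key : ∀ z : X, √(1 ^ 2 + ‖z‖ ^ 2) = ‖WithLp.toLp 2 ((1 : ℝ), z)‖ := by
      intro z
      rw [WithLp.prod_norm_eq_of_L2]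
      simp
    have h1 : WithLp.toLp 2 ((1 : ℝ), a • x + b • y) =
        a • WithLp.toLp 2 ((1 : ℝ), x) + b • WithLp.toLp 2 ((1 : ℝ), y) := by
      refine WithLp.ofLp_injective 2 (Prod.ext ?_ ?_) <;> simp [hab]
    simp only [hc, smoothNorm, key, smul_eq_mul, h1]
    have h2 := norm_add_le (a • WithLp.toLp 2 ((1 : ℝ), x)) (b • WithLp.toLp 2 ((1 : ℝ), y))
    rw [norm_smul, norm_smul, Real.norm_of_nonneg ha, Real.norm_of_nonneg hb] at h2
    linarith
  have hdiff : ContDiff ℝ 1 c := by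
    change ContDiff ℝ 1 fun x : X => √((1 : ℝ) ^ 2 + ‖x‖ ^ 2) - 1
    refine ContDiff.sub (ContDiff.sqrt (contDiff_const.add (contDiff_norm_sq ℝ)) fun x => ?_)
      contDiff_const
    positivity
  have hco : EssentiallyCoercive c :=
    essentiallyCoercive_of_le (l := 0) (a := 1) (b := 1) one_pos fun x => by
      simpa using norm_sub_le_smoothNorm (δ := 1) x
  refine ⟨fun x => c (X.orthogonalProjectionOnto x) + ⟪(0 : EuclideanSpace ℝ (Fin n)), x⟫_ℝ,
    ⟨⟨1, LipschitzWith.of_dist_le_mul fun x y => ?_⟩, hconv.pullback_add_inner 0,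
      hdiff.pullback_add_inner 0, isEmptyElim, isEmptyElim, 0, Xᗮ.zero_mem, c, hco,
      fun x => rfl⟩, ?_⟩
  swap
  · rintro rfl x y
    simp
  rw [Real.dist_eq, dist_eq_norm]
  simpa using abs_pullback_add_inner_sub_le zero_le_one hlip 0 x y

end Euclidean

/-! ### Necessity of the conditions. -/

section Gradient

variable {V : Type*} [NormedAddCommGroup V] [InnerProductSpace ℝ V] [CompleteSpace V] {F : V → ℝ}

theorem norm_gradient_eq (F : V → ℝ) (x : V) : ‖gradient F x‖ = ‖fderiv ℝ F x‖ := by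
  rw [gradient, LinearIsometryEquiv.norm_map]

theorem ContDiff.continuous_gradient (hF : ContDiff ℝ 1 F) : Continuous (gradient F) :=
  (InnerProductSpace.toDual ℝ V).symm.continuous.comp (hF.continuous_fderiv one_ne_zero)

theorem ConvexOn.add_inner_gradient_le (hF : ConvexOn ℝ Set.univ F) (hd : Differentiable ℝ F)
    (x y : V) : F x + ⟪gradient F x, y - x⟫_ℝ ≤ F y :=
  hF.add_inner_le_of_hasGradientAt (hd x).hasGradientAt y

end Gradient

section Euclidean

variable {n : ℕ} {E : Set (EuclideanSpace ℝ (Fin n))} {X : Submodule ℝ (EuclideanSpace ℝ (Fin n))}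
  {f : E → ℝ} {G : E → EuclideanSpace ℝ (Fin n)} {F : EuclideanSpace ℝ (Fin n) → ℝ}

theorem IsCoercivitySubspace.exists_add_eq (h : IsCoercivitySubspace F X) :
    ∃ v ∈ Xᗮ, ∀ x, ∀ u ∈ Xᗮ, F (x + u) = F x + ⟪v, u⟫_ℝ := by
  obtain ⟨v, hv, c, -, hF⟩ := h
  refine ⟨v, hv, fun x u hu => ?_⟩
  rw [hF, hF, map_add, Submodule.orthogonalProjectionOnto_eq_zero_iff.2 hu, add_zero,
    inner_add_right, add_assoc]

/-- Translation along Xᗮ changes F by a constant, so the gradient at x is also a subgradient at x +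
u. -/
theorem IsCoercivitySubspace.gradient_add (h : IsCoercivitySubspace F X)
    (hF : ConvexOn ℝ Set.univ F) (hd : Differentiable ℝ F) (x : EuclideanSpace ℝ (Fin n))
    {u : EuclideanSpace ℝ (Fin n)} (hu : u ∈ Xᗮ) : gradient F (x + u) = gradient F x := by
  obtain ⟨v, -, hv⟩ := h.exists_add_eq
  refine (hd _).hasGradientAt.eq_of_subgradient fun y => ?_
  have h1 := hF.add_inner_gradient_le hd x (y - u)
  have h2 := hv (y - u) u hu
  rw [sub_add_cancel] at h2
  rw [hv x u hu, h2, show y - (x + u) = y - u - x by abel]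
  linarith

theorem IsCoercivitySubspace.gradient_sub_mem (h : IsCoercivitySubspace F X)
    (hF : ConvexOn ℝ Set.univ F) (hd : Differentiable ℝ F) (x y : EuclideanSpace ℝ (Fin n)) :
    gradient F x - gradient F y ∈ X := by
  obtain ⟨v, -, hv⟩ := h.exists_add_eq
  have key : ∀ x, ∀ u ∈ Xᗮ, ⟪gradient F x, u⟫_ℝ = ⟪v, u⟫_ℝ := by
    intro x u hu
    have h1 := hF.add_inner_gradient_le hd x (x + u)
    have h2 := hF.add_inner_gradient_le hd x (x + -u)
    rw [hv x u hu, add_sub_cancel_left] at h1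
    rw [hv x (-u) (neg_mem hu), add_sub_cancel_left, inner_neg_right, inner_neg_right] at h2
    linarith
  rw [← X.orthogonal_orthogonal, Submodule.mem_orthogonal']
  intro u hu
  rw [inner_sub_left, key x u hu, key y u hu, sub_self]

/-- The gradient is uniformly continuous on sets with bounded projection to `X_F`. -/
theorem IsCoercivitySubspace.exists_gradient_modulus (h : IsCoercivitySubspace F X)
    (hF : ConvexOn ℝ Set.univ F) (hC : ContDiff ℝ 1 F) (R : ℝ) {ε : ℝ} (hε : 0 < ε) :
    ∃ r > 0, ∀ x u : EuclideanSpace ℝ (Fin n), ‖X.orthogonalProjectionOnto x‖ ≤ R → ‖u‖ ≤ r →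
      ‖gradient F (x + u) - gradient F x‖ ≤ ε := by
  have hd : Differentiable ℝ F := hC.differentiable one_ne_zero
  have huc := (isCompact_closedBall (0 : EuclideanSpace ℝ (Fin n))
    (R + 1)).uniformContinuousOn_of_continuous hC.continuous_gradient.continuousOn
  rw [Metric.uniformContinuousOn_iff] at huc
  obtain ⟨δ, hδ, hδ'⟩ := huc ε hε
  refine ⟨min 1 (δ / 2), by positivity, fun x u hx hu => ?_⟩
  have hu1 := hu.trans (min_le_left _ _)
  have hu2 := hu.trans (min_le_right _ _)
  set y : EuclideanSpace ℝ (Fin n) := X.starProjection x with hy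
  have hyR : ‖y‖ ≤ R := hx
  have hxy : x - y ∈ Xᗮ := X.sub_starProjection_mem_orthogonal x
  have e1 : gradient F x = gradient F y := by
    rw [← h.gradient_add hF hd y hxy, add_sub_cancel]
  have e2 : gradient F (x + u) = gradient F (y + u) := by
    rw [← h.gradient_add hF hd (y + u) hxy]
    congr 1
    abel
  rw [e1, e2, ← dist_eq_norm]
  refine (hδ' (y + u) ?_ y ?_ ?_).le
  · rw [mem_closedBall_zero_iff]
    exact (norm_add_le _ _).trans (add_le_add hyR hu1)
  · rw [mem_closedBall_zero_iff]
    linarith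
  · rw [dist_self_add_left]
    linarith

theorem IsCoercivitySubspace.tendsto_gradient_sub (h : IsCoercivitySubspace F X)
    (hF : ConvexOn ℝ Set.univ F) (hC : ContDiff ℝ 1 F) {x z : ℕ → EuclideanSpace ℝ (Fin n)}
    (hb : Bornology.IsBounded (Set.range fun k => X.orthogonalProjectionOnto (x k)))
    (hgap : Tendsto (fun k => F (x k) - F (z k) - ⟪gradient F (z k), x k - z k⟫_ℝ) atTop (𝓝 0)) :
    Tendsto (fun k => ‖gradient F (x k) - gradient F (z k)‖) atTop (𝓝 0) := by
  have hd : Differentiable ℝ F := hC.differentiable one_ne_zero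
  obtain ⟨R, hR⟩ := isBounded_iff_forall_norm_le.1 hb
  rw [Metric.tendsto_atTop']
  intro ε hε
  obtain ⟨r, hr, hmod⟩ := h.exists_gradient_modulus hF hC R (half_pos hε)
  obtain ⟨N, hN⟩ := eventually_atTop.1 (hgap.eventually (gt_mem_nhds
    (show 0 < r * (ε / 2) by positivity)))
  refine ⟨N, fun k hk => ?_⟩
  have h1 := hN k hk.le
  -- Evaluating the tangent plane of z k at x k + u bounds r‖∇F(z k) - ∇F(x k)‖ by the gap plus
  -- r‖∇F(x k + u) - ∇F(x k)‖. The first is below r ε/2, the second at most r ε/2.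
  obtain ⟨u, hu, hin⟩ := exists_norm_eq_inner_eq (gradient F (z k) - gradient F (x k)) hr.le
  have h2 := hF.add_inner_gradient_le hd (z k) (x k + u)
  have h3 := hF.add_inner_gradient_le hd (x k + u) (x k)
  have h4 := hmod (x k) u (hR _ ⟨k, rfl⟩) hu
  have h5 := real_inner_le_norm (gradient F (x k + u) - gradient F (x k)) u
  have h6 : ‖gradient F (x k + u) - gradient F (x k)‖ * ‖u‖ ≤ ε / 2 * r := by gcongr
  rw [sub_add_cancel_left, inner_neg_right] at h3
  rw [add_sub_right_comm, inner_add_right] at h2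
  rw [inner_sub_left] at h5 hin
  rw [dist_zero_right, norm_norm, norm_sub_rev]
  have h7 : r * ‖gradient F (z k) - gradient F (x k)‖ < r * ε := by linarith
  exact lt_of_mul_lt_mul_left h7 hr.le

/-- The components orthogonal to `Y` of the differences of the gradients span `X ⊓ Yᗮ`. -/
theorem IsCoercivitySubspace.span_gradient (h : IsCoercivitySubspace F X)
    (hF : ConvexOn ℝ Set.univ F) (hd : Differentiable ℝ F)
    {Y : Submodule ℝ (EuclideanSpace ℝ (Fin n))} (hY : Y ≤ X) (z : EuclideanSpace ℝ (Fin n)) :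
    Submodule.span ℝ (Set.range fun x => Yᗮ.starProjection (gradient F x - gradient F z)) =
      Yᗮ ⊓ X := by
  set S := Submodule.span ℝ
    (Set.range fun x => Yᗮ.starProjection (gradient F x - gradient F z)) with hS
  have hle : S ≤ Yᗮ ⊓ X := by
    refine Submodule.span_le.2 ?_
    rintro _ ⟨x, rfl⟩
    refine ⟨Yᗮ.starProjection_apply_mem _, ?_⟩
    simp only
    rw [Submodule.starProjection_orthogonal_val]
    exact sub_mem (h.gradient_sub_mem hF hd x z) (hY (Y.starProjection_apply_mem _))
  refine le_antisymm hle fun u hu => ?_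
  -- Every gradient has the same inner product with u', so F is affine along u' and u' ∈ Xᗮ. As also
  -- u' ∈ X, it vanishes.
  set u' := u - S.starProjection u with hu'
  have hu'S : u' ∈ Sᗮ := S.sub_starProjection_mem_orthogonal u
  have hu'Y : u' ∈ Yᗮ ⊓ X := sub_mem hu (hle (S.starProjection_apply_mem _))
  have hin : ∀ x, ⟪gradient F x, u'⟫_ℝ = ⟪gradient F z, u'⟫_ℝ := by
    intro x
    have hxS : Yᗮ.starProjection (gradient F x - gradient F z) ∈ S :=
      Submodule.subset_span ⟨x, rfl⟩
    have h1 := Submodule.inner_right_of_mem_orthogonal hxS hu'S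
    rw [Submodule.inner_starProjection_left_eq_right, Submodule.starProjection_eq_self_iff.2 hu'Y.1,
      inner_sub_left] at h1
    linarith
  have hX : u' ∈ Xᗮ := by
    rw [h.mem_orthogonal_iff]
    refine ⟨F 0, ⟪gradient F z, u'⟫_ℝ, fun t => le_antisymm ?_ ?_⟩
    · have h1 := hF.add_inner_gradient_le hd (t • u') 0
      rw [zero_sub, inner_neg_right, real_inner_smul_right, hin] at h1
      linarith
    · have h1 := hF.add_inner_gradient_le hd 0 (t • u')
      rw [sub_zero, real_inner_smul_right, hin] at h1
      linarith
  have h0 : u' = 0 := inner_self_eq_zero.1 (Submodule.inner_right_of_mem_orthogonal hu'Y.2 hX)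
  rw [sub_eq_zero.1 h0]
  exact S.starProjection_apply_mem _

/-- Monotonicity of the gradient keeps the points whose gradients lie in a translate of `Y` away
from a cone with vertex `q`. -/
theorem ConvexOn.notMem_jetCone (hF : ConvexOn ℝ Set.univ F) (hd : Differentiable ℝ F) {K : ℝ}
    (hK : ∀ x, ‖gradient F x‖ ≤ K) {Y : Submodule ℝ (EuclideanSpace ℝ (Fin n))}
    {g q w x : EuclideanSpace ℝ (Fin n)} {s ε : ℝ} (hε : 0 < ε) (hεs : ε * (2 * K) < s)
    (hw : s • w = Yᗮ.starProjection (gradient F q - g)) (hw0 : s • w ≠ 0)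
    (hx : gradient F x - g ∈ Y) : x ∉ jetCone Y ε w q := by
  intro hcone
  simp only [jetCone, Set.mem_ofPred_eq, ge_iff_le] at hcone
  set D := x - q with hD
  set y := Y.starProjection D with hy
  have hyn : ‖Y.orthogonalProjectionOnto D‖ = ‖y‖ := rfl
  rw [hyn] at hcone
  -- η is the Y-component of ∇F x - ∇F q. On the cone monotonicity gives 0 ≤ ⟪η, y⟫ - s⟪w, D⟫ ≤ (2Kε
  -- - s)⟪w, D⟫, which forces ⟪w, D⟫ = 0.
  set η := gradient F x - gradient F q + s • w with hη
  have hηY : η = Y.starProjection (gradient F x - gradient F q) := by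
    have h1 : gradient F x - gradient F q = (gradient F x - g) - (gradient F q - g) := by abel
    rw [hη, hw, Submodule.starProjection_orthogonal_val, h1, map_sub _ (gradient F x - g),
      Submodule.starProjection_eq_self_iff.2 hx]
    abel
  have hηK : ‖η‖ ≤ 2 * K := by
    rw [hηY]
    refine (Y.norm_starProjection_apply_le _).trans ((norm_sub_le _ _).trans ?_)
    linarith [hK x, hK q]
  have hηD : ⟪η, D⟫_ℝ = ⟪η, y⟫_ℝ := by
    have hmem : η ∈ Y := by
      rw [hηY]
      exact Y.starProjection_apply_mem _
    rw [hy, ← Submodule.inner_starProjection_left_eq_right,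
      Submodule.starProjection_eq_self_iff.2 hmem]
  have hsplit : ⟪gradient F x, D⟫_ℝ - ⟪gradient F q, D⟫_ℝ = ⟪η, y⟫_ℝ - s * ⟪w, D⟫_ℝ := by
    rw [← hηD, hη, inner_add_left, inner_sub_left, real_inner_smul_left]
    ring
  have h1 := hF.add_inner_gradient_le hd q x
  have h2 := hF.add_inner_gradient_le hd x q
  rw [← neg_sub x q, inner_neg_right] at h2
  have h3 : ⟪η, y⟫_ℝ ≤ 2 * K * ‖y‖ := (real_inner_le_norm _ _).trans (by gcongr)
  have hK0 : 0 ≤ 2 * K := (norm_nonneg _).trans hηK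
  have h4 : 2 * K * ‖y‖ ≤ 2 * K * (ε * ⟪w, D⟫_ℝ) := by gcongr
  have hω : 0 ≤ ⟪w, D⟫_ℝ := nonneg_of_mul_nonneg_right ((norm_nonneg _).trans hcone) hε
  have hω0 : ⟪w, D⟫_ℝ = 0 := by
    by_contra hne
    have hpos : 0 < ⟪w, D⟫_ℝ := lt_of_le_of_ne hω (Ne.symm hne)
    nlinarith [mul_pos (sub_pos.2 hεs) hpos]
  -- In this remaining case F touches its tangent plane of q at x, so both gradients agree and the
  -- Yᗮ-component s • w would be zero.
  have hFx : F x = F q + ⟪gradient F q, D⟫_ℝ := by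
    refine le_antisymm ?_ h1
    rw [hω0, mul_zero, mul_zero] at h4
    rw [hω0, mul_zero, sub_zero] at hsplit
    linarith
  have hgrad : gradient F x = gradient F q := (hd x).hasGradientAt.eq_of_subgradient fun u => by
    have h5 := hF.add_inner_gradient_le hd q u
    rw [hFx, add_assoc, ← inner_add_right, hD, add_comm (x - q), sub_add_sub_cancel]
    exact h5
  apply hw0
  rw [hw, ← hgrad, Submodule.starProjection_orthogonal_val,
    Submodule.starProjection_eq_self_iff.2 hx, sub_self]

/-- The vertices are points whose gradients have Yᗮ-components v j forming a basis of X ⊓ Yᗮ, and ε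
is small against ‖v j‖ / (2K). Closure points of E are covered because ∇F x - ∇F z ∈ Y is a closed
condition. Each vertex lies in its own cone, hence off the closure. -/
theorem IsLipschitzConvexExtension.exists_cones (h : IsLipschitzConvexExtension X f G F)
    (hle : jetSpan G ≤ X) {K : ℝ} (hK : ∀ x, ‖gradient F x‖ ≤ K) :
    ∃ (p : Fin (Module.finrank ℝ X - Module.finrank ℝ (jetSpan G)) → EuclideanSpace ℝ (Fin n))
      (ε : ℝ)
      (w : Fin (Module.finrank ℝ X - Module.finrank ℝ (jetSpan G)) → EuclideanSpace ℝ (Fin n)),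
      (∀ j, p j ∉ closure E) ∧ 0 < ε ∧ ε < 1 ∧ LinearIndependent ℝ w ∧ (∀ j, ‖w j‖ = 1) ∧
      (∀ j, w j ∈ X ⊓ (jetSpan G)ᗮ) ∧
      ∀ j, ∀ x ∈ closure E, x ∉ jetCone (jetSpan G) ε (w j) (p j) := by
  have hd : Differentiable ℝ F := h.contDiff.differentiable one_ne_zero
  obtain ⟨z, hz⟩ : ∃ z, ∀ x ∈ E, gradient F x - gradient F z ∈ jetSpan G := by
    rcases E.eq_empty_or_nonempty with rfl | ⟨z, hz⟩
    · exact ⟨0, fun x hx => hx.elim⟩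
    · refine ⟨z, fun x hx => Submodule.subset_span ⟨⟨x, hx⟩, ⟨z, hz⟩, ?_⟩⟩
      rw [← h.gradient_eq, ← h.gradient_eq]
  have hz' : ∀ x ∈ closure E, gradient F x - gradient F z ∈ jetSpan G := by
    have hcl : IsClosed {x | gradient F x - gradient F z ∈ jetSpan G} :=
      (jetSpan G).closed_of_finiteDimensional.preimage
        (h.contDiff.continuous_gradient.sub continuous_const)
    exact fun x hx => closure_minimal hz hcl hx
  have hspan := h.subspace_eq.span_gradient h.convex hd hle z
  obtain ⟨v, hv, hv2, hli⟩ := Submodule.exists_fun_fin_finrank_span_eq ℝ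
    (Set.range fun x => (jetSpan G)ᗮ.starProjection (gradient F x - gradient F z))
  have hrank : Module.finrank ℝ (Submodule.span ℝ (Set.range fun x =>
      (jetSpan G)ᗮ.starProjection (gradient F x - gradient F z))) =
      Module.finrank ℝ X - Module.finrank ℝ (jetSpan G) := by
    have := Submodule.finrank_add_inf_finrank_orthogonal hle
    rw [hspan]
    omega
  rw [← hrank]
  choose p hp using hv
  have hpos : ∀ j, 0 < ‖v j‖ := fun j => norm_pos_iff.2 (hli.ne_zero j)
  have hev : ∀ᶠ ε : ℝ in 𝓝[>] 0, ∀ j, ε * (2 * K) < ‖v j‖ := by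
    refine eventually_all.2 fun j => ?_
    have hc : Continuous fun ε : ℝ => ε * (2 * K) := by fun_prop
    have := hc.tendsto 0
    rw [zero_mul] at this
    exact (this.eventually (gt_mem_nhds (hpos j))).filter_mono nhdsWithin_le_nhds
  obtain ⟨ε, hε1, hε2⟩ := (hev.and (Ioo_mem_nhdsGT one_pos)).exists
  have hvw : ∀ j, ‖v j‖ • (‖v j‖⁻¹ • v j) = v j := fun j => smul_inv_smul₀ (hpos j).ne' _
  have hcone : ∀ j, ∀ x ∈ closure E, x ∉ jetCone (jetSpan G) ε (‖v j‖⁻¹ • v j) (p j) :=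
    fun j x hx => h.convex.notMem_jetCone hd hK hε2.1 (hε1 j) ((hvw j).trans (hp j).symm)
      (by rw [hvw]; exact hli.ne_zero j) (hz' x hx)
  refine ⟨p, ε, fun j => ‖v j‖⁻¹ • v j, fun j hj => hcone j _ hj ?_, hε2.1, hε2.2, ?_, fun j => ?_,
    fun j => ?_, hcone⟩
  · simp [jetCone]
  · exact hli.units_smul fun j => (Units.mk0 _ (hpos j).ne')⁻¹
  · rw [norm_smul, norm_inv, norm_norm, inv_mul_cancel₀ (hpos j).ne']
  · have h1 : v j ∈ (jetSpan G)ᗮ ⊓ X := by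
      rw [← hspan, ← hv2]
      exact Submodule.subset_span ⟨j, rfl⟩
    exact Submodule.smul_mem _ _ ⟨h1.2, h1.1⟩

theorem IsLipschitzConvexExtension.exists_norm_gradient_le
    (h : IsLipschitzConvexExtension X f G F) : ∃ K, ∀ x, ‖gradient F x‖ ≤ K := by
  obtain ⟨L, hL⟩ := h.lipschitz
  refine ⟨L, fun x => ?_⟩
  rw [norm_gradient_eq]
  exact norm_fderiv_le_of_lipschitz ℝ hL

theorem IsLipschitzConvexExtension.jetConditions (h : IsLipschitzConvexExtension X f G F) :
    LipschitzJetConditions X f G := by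
  have hd : Differentiable ℝ F := h.contDiff.differentiable one_ne_zero
  obtain ⟨K, hK⟩ := h.exists_norm_gradient_le
  have hspan : jetSpan G ≤ X := by
    refine Submodule.span_le.2 ?_
    rintro _ ⟨x, y, rfl⟩
    rw [← h.gradient_eq, ← h.gradient_eq]
    exact h.subspace_eq.gradient_sub_mem h.convex hd x y
  refine ⟨⟨?_, ?_, fun x y => ?_⟩, hspan, fun _ => h.exists_cones hspan hK, fun x z hb hgap => ?_⟩
  · have : G = fun x : E => gradient F x := funext fun x => (h.gradient_eq x).symm
    rw [this]
    exact h.contDiff.continuous_gradient.comp continuous_subtype_val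
  · refine isBounded_iff_forall_norm_le.2 ⟨K, ?_⟩
    rintro _ ⟨x, rfl⟩
    rw [← h.gradient_eq]
    exact hK x
  · rw [← h.value_eq, ← h.value_eq, ← h.gradient_eq]
    exact h.convex.add_inner_gradient_le hd y x
  · simp only [← h.value_eq, ← h.gradient_eq] at hgap ⊢
    exact h.subspace_eq.tendsto_gradient_sub h.convex h.contDiff hb hgap

/-! ### The Lipschitz constant and the main theorem. -/

theorem lipConst_le {L : ℝ} (hL : 0 ≤ L) (h : ∀ x y, |F x - F y| ≤ L * ‖x - y‖) :
    lipConst F ≤ L :=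
  csInf_le ⟨0, fun _ hl => hl.1⟩ ⟨hL, h⟩

theorem IsLipschitzConvexExtension.lipConst_eq (h : IsLipschitzConvexExtension X f G F) :
    lipConst F = ⨆ x, ‖gradient F x‖ := by
  have hd : Differentiable ℝ F := h.contDiff.differentiable one_ne_zero
  obtain ⟨K, hK⟩ := h.exists_norm_gradient_le
  have hbdd : BddAbove (Set.range fun x => ‖gradient F x‖) := ⟨K, by
    rintro _ ⟨x, rfl⟩
    exact hK x⟩
  refine IsLeast.csInf_eq ⟨⟨Real.iSup_nonneg fun x => norm_nonneg _, fun x y => ?_⟩, ?_⟩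
  · have := convex_univ.norm_image_sub_le_of_norm_fderiv_le (fun z _ => hd z)
      (fun z _ => (norm_gradient_eq F z).symm.trans_le (le_ciSup hbdd z)) (Set.mem_univ y)
      (Set.mem_univ x)
    rwa [Real.norm_eq_abs] at this
  · rintro L ⟨hL, hFL⟩
    refine ciSup_le fun x => ?_
    rw [norm_gradient_eq]
    refine norm_fderiv_le_of_lipschitz ℝ (C := ⟨L, hL⟩) (LipschitzWith.of_dist_le_mul fun x y => ?_)
    rw [Real.dist_eq, dist_eq_norm]
    exact hFL x y

/-- Here Xᗮ is the whole space, so F is affine with slope G z. This settles X = ⊥ even when G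
vanishes. -/
theorem IsLipschitzConvexExtension.abs_sub_le_of_eq_bot (h : IsLipschitzConvexExtension X f G F)
    (hX : X = ⊥) (z : E) (x y : EuclideanSpace ℝ (Fin n)) : |F x - F y| ≤ ‖G z‖ * ‖x - y‖ := by
  obtain ⟨v, -, hv⟩ := h.subspace_eq.exists_add_eq
  have hv' : ∀ x y, F x = F y + ⟪v, x - y⟫_ℝ := fun x y => by
    rw [← hv y (x - y) (by simp [hX]), add_sub_cancel]
  have hG : G z = v := by
    rw [← h.gradient_eq]
    exact (h.contDiff.differentiable one_ne_zero _).hasGradientAt.eq_of_subgradient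
      fun y => (hv' y z).ge
  rw [hv' x y, add_sub_cancel_left, hG]
  exact abs_real_inner_le_norm _ _

end Euclidean

theorem mainTheorem3 (n : ℕ) :
    ∃ C : ℝ, 0 < C ∧
      ∀ (E : Set (EuclideanSpace ℝ (Fin n))) (X : Submodule ℝ (EuclideanSpace ℝ (Fin n)))
        (f : E → ℝ) (G : E → EuclideanSpace ℝ (Fin n)),
        ((∃ F : EuclideanSpace ℝ (Fin n) → ℝ, IsLipschitzConvexExtension X f G F) ↔
          LipschitzJetConditions X f G) ∧
        (LipschitzJetConditions X f G → (X = ⊥ ∨ ∃ y : E, G y ≠ 0) →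
          ∃ F : EuclideanSpace ℝ (Fin n) → ℝ, IsLipschitzConvexExtension X f G F ∧
            lipConst F = ⨆ x, ‖gradient F x‖ ∧
            lipConst F ≤ C * ⨆ y : E, ‖G y‖) := by
  -- The constant does not depend on n: 20 = 10 · 2, since the added jets double the slope bound.
  refine ⟨20, by norm_num, fun E X f G => ?_⟩
  have hbdd : LipschitzJetConditions X f G → BddAbove (Set.range fun y : E => ‖G y‖) := by
    intro h
    obtain ⟨K, hK⟩ := isBounded_iff_forall_norm_le.1 h.basic.2.1
    exact ⟨K, by
      rintro _ ⟨y, rfl⟩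
      exact hK _ ⟨y, rfl⟩⟩
  have hsup : 0 ≤ ⨆ y : E, ‖G y‖ := Real.iSup_nonneg fun y => norm_nonneg _
  have hex : LipschitzJetConditions X f G → Nonempty E →
      ∃ F : EuclideanSpace ℝ (Fin n) → ℝ, IsLipschitzConvexExtension X f G F := by
    intro h _
    -- The summand 1 keeps the slope bound positive when G is identically zero.
    obtain ⟨F, hF, -⟩ := h.exists_extension (L := (⨆ y : E, ‖G y‖) + 1) (by positivity)
      fun y => (le_ciSup (hbdd h) y).trans (by linarith)
    exact ⟨F, hF⟩
  rcases isEmpty_or_nonempty E with hE | hE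
  · obtain ⟨F, hF, hF0⟩ := exists_extension_of_isEmpty (X := X) (f := f) (G := G)
    refine ⟨⟨fun ⟨F, hF⟩ => hF.jetConditions, fun _ => ⟨F, hF⟩⟩, fun _ h => ?_⟩
    have hX : X = ⊥ := h.resolve_right fun ⟨y, _⟩ => hE.elim y
    refine ⟨F, hF, hF.lipConst_eq, (lipConst_le le_rfl fun x y => ?_).trans (by positivity)⟩
    simp [hF0 hX x y]
  · refine ⟨⟨fun ⟨F, hF⟩ => hF.jetConditions, fun h => hex h hE⟩, fun h hXG => ?_⟩
    rcases hXG with hX | ⟨y, hy⟩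
    · obtain ⟨F, hF⟩ := hex h hE
      obtain ⟨z⟩ := hE
      have h1 := lipConst_le (norm_nonneg _) (hF.abs_sub_le_of_eq_bot hX z)
      have h2 := le_ciSup (hbdd h) z
      exact ⟨F, hF, hF.lipConst_eq, by linarith⟩
    · have hpos : 0 < ⨆ y : E, ‖G y‖ := (norm_pos_iff.2 hy).trans_le (le_ciSup (hbdd h) y)
      obtain ⟨F, hF, hL⟩ := h.exists_extension hpos fun y => le_ciSup (hbdd h) y
      exact ⟨F, hF, hF.lipConst_eq, lipConst_le (by positivity) hL⟩
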